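/- Let $n\ge 1$, let $\Omega\subset\mathbb{R}^n$ be a bounded domain (a non-empty, bounded, connected open set) whose boundary is of class $C^1$, and let $p=\min\{4/n,1\}$. Here the boundary is of class $C^1$ if every $x_0\in\partial\Omega$ has a ball $B$ around it in which, after a rotation of the coordinates, $\Omega\cap B$ is the set of points of $B$ lying strictly above the graph of a $C^1$ function of the first $n-1$ coordinates. Then there exists a constant $C>0$, depending only on $n$ and $\Omega$, such that for every $R\in H^1(\Omega)$ with $\int_\Omega R\,dx=0$, $$\|R\|_{L^{2+p}(\Omega)}^{2+p}\le C\,\|R\|_{L^2(\Omega)}^{p}\,\|\nabla R\|_{L^2(\Omega)}^{2},$$ where $\nabla R$ is the weak gradient of $R$. (In particular $R\in L^{2+p}(\Omega)$.) -/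

import Mathlib

open MeasureTheory
open scoped ENNReal ContDiff

/-- `Ω ⊆ ℝⁿ` has a boundary of class `C¹`: near every boundary point there are a unit vector `ν`
and a `C¹` function `γ` on the hyperplane `ν^⊥` such that, inside a small ball centred at that
point, `Ω` is exactly the part of the ball lying strictly above the graph of `γ` over `ν^⊥`
in the direction `ν`. -/
def HasC1Boundary {n : ℕ} (Ω : Set (EuclideanSpace ℝ (Fin n))) : Prop :=
  ∀ x₀ ∈ frontier Ω, ∃ r : ℝ, 0 < r ∧ ∃ ν : EuclideanSpace ℝ (Fin n), ‖ν‖ = 1 ∧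
    ∃ γ : (Submodule.span ℝ {ν})ᗮ → ℝ, ContDiff ℝ 1 γ ∧
      ∀ x ∈ Metric.ball x₀ r,
        (x ∈ Ω ↔ γ ((Submodule.span ℝ {ν})ᗮ.orthogonalProjectionOnto x) < inner ℝ x ν)

/-- `G` is a weak (distributional) gradient of `R` on the open set `Ω`: both are locally integrable
on `Ω`, and `∫_Ω R ∂ᵢφ = - ∫_Ω Gᵢ φ` for every coordinate `i` and every test function
`φ ∈ C_c^∞(Ω)`. -/
structure IsWeakGradient {n : ℕ} (Ω : Set (EuclideanSpace ℝ (Fin n)))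
    (R : EuclideanSpace ℝ (Fin n) → ℝ)
    (G : EuclideanSpace ℝ (Fin n) → EuclideanSpace ℝ (Fin n)) : Prop where
  locallyIntegrable : LocallyIntegrableOn R Ω volume
  locallyIntegrable_grad : LocallyIntegrableOn G Ω volume
  integral_eq : ∀ φ : EuclideanSpace ℝ (Fin n) → ℝ, ContDiff ℝ ∞ φ → HasCompactSupport φ →
    tsupport φ ⊆ Ω → ∀ i : Fin n,
      ∫ x in Ω, R x * fderiv ℝ φ x (EuclideanSpace.single i 1) = - ∫ x in Ω, G x i * φ x

/-- `R ∈ H¹(Ω)`: `R ∈ L²(Ω)` and `R` has a weak gradient that belongs to `L²(Ω)`. -/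
def MemH1 {n : ℕ} (Ω : Set (EuclideanSpace ℝ (Fin n))) (R : EuclideanSpace ℝ (Fin n) → ℝ) :
    Prop :=
  MemLp R 2 (volume.restrict Ω) ∧
    ∃ G : EuclideanSpace ℝ (Fin n) → EuclideanSpace ℝ (Fin n),
      IsWeakGradient Ω R G ∧ MemLp G 2 (volume.restrict Ω)

/-! Put `q = 4 / (2 - p)`. Hölder's inequality between `L²` and `L^q` gives `∫ |R|^(2+p) ≤ (∫
|R|²)^(p/2) (∫ |R|^q)^((2-p)/2)`, so it suffices to bound the `L^q` norm of a mean-zero `R` by the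
`L²` norm of its gradient. The condition `p ≤ 4/n` says exactly that `q` is at most the Sobolev
exponent: `(n - 2) q ≤ 2n`. This Sobolev–Poincaré inequality (`exists_sobolev_poincare`) combines
`exists_sobolev` with `poincareOn_self`.

The Sobolev inequality is proved without an extension operator. Near a point of `closure Ω`, `Ω`
agrees with an open set `U` stable under translation along the negative half-lines of some basis
(`exists_isOpen_invariant_of_hasC1Boundary`). A compactly supported function is controlled at a
point of `U` by integrals of its derivative along these half-lines, which never leave `U`;
Gagliardo's inequality turns this into an `L^q` bound. Mollification and Fatou's lemma carry the
bound to weak gradients, and cutoffs with compactness of `closure Ω` make it global.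

For Poincaré, balls are treated by integrating differences along segments, and connectedness glues
balls into a set covering any prescribed compact `K ⊆ Ω`. On the layer `Ω \ K`, of small measure,
Hölder and Sobolev bound the `L²` mass by half of the total plus a gradient term, and that half is
absorbed. -/

/-! ### Hölder's and Gagliardo's inequalities -/

theorem lintegral_rpow_le_of_support {α : Type*} [MeasurableSpace α] {μ : Measure α} {r s : ℝ}
    (hr : 0 < r) (hrs : r ≤ s) {K : Set α} {F : α → ℝ≥0∞} (hF : AEMeasurable F μ)
    (hFK : ∀ x ∉ K, F x = 0) :
    ∫⁻ x, F x ^ r ∂μ ≤ μ K ^ (1 - r / s) * (∫⁻ x, F x ^ s ∂μ) ^ (r / s) := by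
  have hs : 0 < s := hr.trans_le hrs
  calc ∫⁻ x, F x ^ r ∂μ ≤ ∫⁻ x in K, F x ^ r ∂μ := by
        rw [← setLIntegral_eq_of_support_subset (s := K)]
        intro x hx
        by_contra h
        simp [hFK x h, hr] at hx
    _ = ∫⁻ x in K, (1 : ℝ≥0∞) ^ (1 - r / s) * (F x ^ s) ^ (r / s) ∂μ := by
        congr! 2 with x
        rw [← ENNReal.rpow_mul, mul_div_cancel₀ _ hs.ne', ENNReal.one_rpow, one_mul]
    _ ≤ (∫⁻ _ in K, (1 : ℝ≥0∞) ∂μ) ^ (1 - r / s) * (∫⁻ x in K, F x ^ s ∂μ) ^ (r / s) := by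
        refine ENNReal.lintegral_mul_norm_pow_le aemeasurable_const
          (hF.restrict.pow_const _) ?_ (by positivity) (by ring)
        rw [sub_nonneg, div_le_one hs]; exact hrs
    _ ≤ _ := by
        rw [setLIntegral_one]
        gcongr
        exact Measure.restrict_le_self

theorem lintegral_rpow_le_of_le_lintegral_update {ι : Type*} [Fintype ι] [DecidableEq ι]
    [Nonempty ι] {r : ℝ} (hr : 0 < r) (hrn : ((Fintype.card ι : ℝ) - 1) * r ≤ Fintype.card ι)
    {K : Set (ι → ℝ)} {F H : (ι → ℝ) → ℝ≥0∞} (hF : Measurable F) (hH : Measurable H)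
    (hFK : ∀ x ∉ K, F x = 0) (hFH : ∀ x i, F x ≤ ∫⁻ t, H (Function.update x i t)) :
    ∫⁻ x, F x ^ r ≤ volume K ^ (1 - ((Fintype.card ι : ℝ) - 1) / Fintype.card ι * r) *
      (∫⁻ x, H x) ^ r := by
  -- In dimension one the exponent `n / (n - 1)` degenerates, but the only line is the whole space,
  -- so `F` is bounded by the constant `∫ H`.
  rcases (Nat.succ_le_of_lt (Fintype.card_pos (α := ι))).eq_or_lt with h1 | h1
  · have : Subsingleton ι := Fintype.card_le_one_iff_subsingleton.1 h1.ge
    have hu : Unique ι := uniqueOfSubsingleton (Classical.arbitrary ι)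
    have hle : ∀ x, F x ≤ ∫⁻ y, H y := fun x ↦ by
      refine (hFH x default).trans_eq ?_
      have hpi : (volume : Measure (ι → ℝ)).map (MeasurableEquiv.funUnique ι ℝ) = volume := by
        convert (volume_preserving_funUnique ι ℝ).map_eq
        rfl
      rw [← hpi, lintegral_map_equiv]
      congr! 2 with y
      congr 1
      ext i
      simp [Subsingleton.elim i default]
    have h1' : (Fintype.card ι : ℝ) - 1 = 0 := by rw [← h1]; simp
    rw [h1', zero_div, zero_mul, sub_zero, ENNReal.rpow_one, mul_comm]
    calc ∫⁻ x, F x ^ r ≤ ∫⁻ x in K, F x ^ r := by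
          rw [← setLIntegral_eq_of_support_subset (s := K)]
          intro x hx
          by_contra h
          simp [hFK x h, hr] at hx
      _ ≤ ∫⁻ x in K, (∫⁻ y, H y) ^ r := by gcongr with x; exact hle x
      _ = _ := by rw [setLIntegral_const]
  · have hn : (1 : ℝ) < Fintype.card ι := by exact_mod_cast h1
    set n : ℝ := (Fintype.card ι : ℝ)
    have hc : n.HolderConjugate (n / (n - 1)) := .conjExponent hn
    have hn1 : 0 < n - 1 := by linarith
    have key : ∫⁻ x, F x ^ (n / (n - 1)) ≤ (∫⁻ x, H x) ^ (n / (n - 1)) := by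
      calc ∫⁻ x, F x ^ (n / (n - 1))
          = ∫⁻ x, ∏ _i : ι, F x ^ (1 / (n - 1)) := by
            congr! 2 with x
            rw [Finset.prod_const, ← ENNReal.rpow_natCast, ← ENNReal.rpow_mul]
            congr 1
            change _ = _ * n
            field_simp
        _ ≤ ∫⁻ x, ∏ i, (∫⁻ t, H (Function.update x i t)) ^ (1 / (n - 1)) := by
            gcongr with x i
            exact hFH x i
        _ ≤ _ := lintegral_prod_lintegral_pow_le _ hc hH
    -- Gagliardo's inequality is the endpoint exponent; smaller `r` follow by Hölder, at the cost of
    -- a power of the measure of `K`.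
    have hrs : r ≤ n / (n - 1) := by rw [le_div_iff₀ hn1]; linarith
    refine (lintegral_rpow_le_of_support hr hrs hF.aemeasurable hFK).trans ?_
    have e : r / (n / (n - 1)) = (n - 1) / n * r := by field_simp
    rw [e]
    gcongr
    refine (ENNReal.rpow_le_rpow key (by positivity)).trans_eq ?_
    rw [← ENNReal.rpow_mul]
    congr 1
    field_simp

/-- Gagliardo's inequality for a function dominated by its line integrals in the directions of a
basis. -/
theorem exists_lintegral_rpow_le_of_le_lintegral_line {E ι : Type*} [NormedAddCommGroup E]
    [NormedSpace ℝ E] [MeasurableSpace E] [BorelSpace E] [FiniteDimensional ℝ E] (μ : Measure E)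
    [μ.IsAddHaarMeasure] [Fintype ι] [Nonempty ι] (b : Module.Basis ι ℝ E) {r : ℝ} (hr : 0 < r)
    (hrn : ((Fintype.card ι : ℝ) - 1) * r ≤ Fintype.card ι) {K : Set E} (hK : μ K ≠ ⊤) :
    ∃ C : ℝ≥0∞, C ≠ ⊤ ∧ ∀ F H : E → ℝ≥0∞, Measurable F → Measurable H → (∀ x ∉ K, F x = 0) →
      (∀ x i, F x ≤ ∫⁻ t : ℝ, H (x + t • b i)) → ∫⁻ x, F x ^ r ∂μ ≤ C * (∫⁻ x, H x ∂μ) ^ r := by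
  classical
  let e : E ≃L[ℝ] (ι → ℝ) := b.equivFun.toContinuousLinearEquiv
  let m : (ι → ℝ) ≃ᵐ E := e.symm.toHomeomorph.toMeasurableEquiv
  let ν : Measure E := (volume : Measure (ι → ℝ)).map e.symm
  let c := Measure.addHaarScalarFactor μ ν
  have hc : 0 < c := Measure.addHaarScalarFactor_pos_of_isAddHaarMeasure ..
  have hμ : μ = c • ν := Measure.isAddLeftInvariant_eq_smul ..
  have hν : ∀ f : E → ℝ≥0∞, ∫⁻ x, f x ∂ν = ∫⁻ y, f (e.symm y) := fun f ↦ lintegral_map_equiv f m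
  have hνK : volume (e.symm ⁻¹' K) ≠ ⊤ := by
    have : ν K = volume (e.symm ⁻¹' K) := m.map_apply K
    rw [← this]
    intro h
    rw [hμ] at hK
    rw [Measure.smul_apply, h, ENNReal.smul_def, smul_eq_mul, ENNReal.mul_top (by exact_mod_cast hc.ne')] at hK
    exact hK rfl
  set n : ℝ := (Fintype.card ι : ℝ)
  have hn : 1 ≤ n := Nat.one_le_cast.2 Fintype.card_pos
  refine ⟨c * volume (e.symm ⁻¹' K) ^ (1 - (n - 1) / n * r) * ((c : ℝ≥0∞)⁻¹) ^ r, ?_, ?_⟩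
  · refine ENNReal.mul_ne_top (ENNReal.mul_ne_top ENNReal.coe_ne_top ?_) ?_
    · refine ENNReal.rpow_ne_top_of_nonneg ?_ hνK
      rw [sub_nonneg, div_mul_eq_mul_div, div_le_one (by linarith)]
      exact hrn
    · exact ENNReal.rpow_ne_top_of_nonneg hr.le (by simp [hc.ne'])
  · intro F H hF hH hFK hFH
    have key := lintegral_rpow_le_of_le_lintegral_update (K := e.symm ⁻¹' K)
      (F := fun y ↦ F (e.symm y)) (H := fun y ↦ H (e.symm y)) hr hrn
      (hF.comp e.symm.continuous.measurable) (hH.comp e.symm.continuous.measurable)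
      (fun x hx ↦ hFK _ hx) ?_
    · rw [hμ, ENNReal.smul_def, lintegral_smul_measure, lintegral_smul_measure, hν, hν,
        smul_eq_mul, smul_eq_mul, ENNReal.mul_rpow_of_nonneg _ _ hr.le]
      refine (mul_le_mul_right key _).trans_eq ?_
      have : ((c : ℝ≥0∞)⁻¹) ^ r * (c : ℝ≥0∞) ^ r = 1 := by
        rw [← ENNReal.mul_rpow_of_nonneg _ _ hr.le, ENNReal.inv_mul_cancel (by simp [hc.ne'])
          ENNReal.coe_ne_top, ENNReal.one_rpow]
      calc c * (volume (e.symm ⁻¹' K) ^ (1 - (n - 1) / n * r) * (∫⁻ x, H (e.symm x)) ^ r)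
          = c * volume (e.symm ⁻¹' K) ^ (1 - (n - 1) / n * r) * (((c : ℝ≥0∞)⁻¹) ^ r *
            (c : ℝ≥0∞) ^ r) * (∫⁻ x, H (e.symm x)) ^ r := by rw [this]; ring
        _ = _ := by ring
    · intro x i
      refine (hFH (e.symm x) i).trans_eq ?_
      rw [← lintegral_sub_right_eq_self (μ := volume) _ (x i)]
      congr! 2 with t
      congr 1
      apply e.injective
      ext j
      rw [map_add, map_smul]
      have : e (b i) = Pi.single i 1 := by
        ext j; simp [e, Pi.single_apply, eq_comm]
      rw [this]
      by_cases h : j = i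
      · subst h; simp
      · simp [h]

/-! ### Weak gradients and mollification -/

/-- `g` is the weak gradient on `U` of `u`, both functions being integrable on the whole space. -/
structure HasWeakGradientOn {E : Type*} [NormedAddCommGroup E] [InnerProductSpace ℝ E]
    [MeasurableSpace E] (u : E → ℝ) (g : E → E) (U : Set E) (μ : Measure E) : Prop where
  integrable : Integrable u μ
  integrable_grad : Integrable g μ
  integral_eq : ∀ φ : E → ℝ, ContDiff ℝ ∞ φ → HasCompactSupport φ → tsupport φ ⊆ U → ∀ w : E,
    ∫ x, u x * fderiv ℝ φ x w ∂μ = - ∫ x, inner ℝ (g x) w * φ x ∂μ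

section Mollification

variable {E : Type*} [NormedAddCommGroup E] [InnerProductSpace ℝ E] [FiniteDimensional ℝ E]
  [MeasurableSpace E] [BorelSpace E] {μ : Measure E} [μ.IsAddHaarMeasure]

/-- The mollification of `u` by a bump function. -/
noncomputable def mollify (φ : ContDiffBump (0 : E)) (u : E → ℝ) (μ : Measure E) : E → ℝ :=
  convolution u (φ.normed μ) (ContinuousLinearMap.mul ℝ ℝ) μ

/-- The mollification of an extended nonnegative function by a bump function. -/
noncomputable def lmollify (φ : ContDiffBump (0 : E)) (h : E → ℝ≥0∞) (μ : Measure E) (x : E) :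
    ℝ≥0∞ :=
  ∫⁻ t, h t * ENNReal.ofReal (φ.normed μ (x - t)) ∂μ

theorem contDiff_mollify (φ : ContDiffBump (0 : E)) {u : E → ℝ} (hu : Integrable u μ) :
    ContDiff ℝ 1 (mollify φ u μ) :=
  φ.hasCompactSupport_normed.contDiff_convolution_right (n := 1) _ hu.locallyIntegrable
    φ.contDiff_normed

theorem mollify_eq_zero (φ : ContDiffBump (0 : E)) {u : E → ℝ} {x : E}
    (h : ∀ y ∈ Metric.ball x φ.rOut, u y = 0) : mollify φ u μ x = 0 := by
  rw [mollify, convolution_def]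
  refine integral_eq_zero_of_ae (.of_forall fun t ↦ ?_)
  by_cases ht : t ∈ Metric.ball x φ.rOut
  · simp [h t ht]
  · have : x - t ∉ Function.support (φ.normed μ) := by
      rw [φ.support_normed_eq]
      simpa [dist_eq_norm, norm_sub_rev] using ht
    simp [Function.notMem_support.1 this]

theorem ae_tendsto_mollify {φ : ℕ → ContDiffBump (0 : E)}
    (hφ : Filter.Tendsto (fun i ↦ (φ i).rOut) Filter.atTop (nhds 0))
    (hφ' : ∀ i, (φ i).rOut ≤ 2 * (φ i).rIn) {u : E → ℝ} (hu : Integrable u μ) :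
    ∀ᵐ x ∂μ, Filter.Tendsto (fun i ↦ mollify (φ i) u μ x) Filter.atTop (nhds (u x)) := by
  filter_upwards [ContDiffBump.ae_convolution_tendsto_right_of_locallyIntegrable (μ := μ) hφ
    (.of_forall hφ') hu.locallyIntegrable] with x hx
  refine hx.congr fun i ↦ ?_
  rw [mollify, convolution_def, convolution_eq_swap]
  simp [mul_comm]

/-- The derivative falls on the bump, and `t ↦ φ.normed μ (x - t)` is a test function supported in
the closed ball of radius `φ.rOut` about `x`. As this ball lies in `U`, the weak gradient identity
applies; the two signs cancel. -/
theorem fderiv_mollify (φ : ContDiffBump (0 : E)) {u : E → ℝ} {g : E → E} {U : Set E}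
    (h : HasWeakGradientOn u g U μ) {x : E} (hx : Metric.closedBall x φ.rOut ⊆ U) (w : E) :
    fderiv ℝ (mollify φ u μ) x w = ∫ t, inner ℝ (g t) w * φ.normed μ (x - t) ∂μ := by
  have hd := (φ.hasCompactSupport_normed (μ := μ)).hasFDerivAt_convolution_right (𝕜 := ℝ) (μ := μ)
    (ContinuousLinearMap.mul ℝ ℝ) h.integrable.locallyIntegrable (φ.contDiff_normed (n := 1)) x
  rw [mollify, hd.fderiv, convolution_precompR_apply _ h.integrable.locallyIntegrable
    (φ.hasCompactSupport_normed.fderiv ℝ) (φ.contDiff_normed.continuous_fderiv one_ne_zero),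
    convolution_def]
  have hs : ContDiff ℝ ∞ fun t ↦ φ.normed μ (x - t) :=
    φ.contDiff_normed.comp (contDiff_const.sub contDiff_id)
  have hsupp : tsupport (fun t ↦ φ.normed μ (x - t)) ⊆ Metric.closedBall x φ.rOut := by
    refine closure_minimal (fun t ht ↦ ?_) Metric.isClosed_closedBall
    have : x - t ∈ Function.support (φ.normed μ) := ht
    rw [φ.support_normed_eq] at this
    refine Metric.ball_subset_closedBall ?_
    simpa [dist_eq_norm, norm_sub_rev] using this
  have hc : HasCompactSupport fun t ↦ φ.normed μ (x - t) :=
    HasCompactSupport.of_support_subset_isCompact (isCompact_closedBall x φ.rOut)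
      (subset_closure.trans hsupp)
  rw [← neg_neg (∫ t, inner ℝ (g t) w * φ.normed μ (x - t) ∂μ),
    ← h.integral_eq _ hs hc (hsupp.trans hx) w, ← integral_neg]
  congr! 2 with t
  have h1 : HasFDerivAt (fun t ↦ φ.normed μ (x - t))
      ((fderiv ℝ (φ.normed μ) (x - t)).comp (-ContinuousLinearMap.id ℝ E)) t := by
    have h2 := ((φ.contDiff_normed (μ := μ) (n := 1)).differentiable one_ne_zero (x - t))
    exact h2.hasFDerivAt.comp t ((hasFDerivAt_id t).const_sub x)
  rw [h1.fderiv]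
  simp

theorem enorm_fderiv_mollify_le (φ : ContDiffBump (0 : E)) {u : E → ℝ} {g : E → E} {U : Set E}
    (h : HasWeakGradientOn u g U μ) {x : E} (hx : Metric.closedBall x φ.rOut ⊆ U) (w : E) :
    ‖fderiv ℝ (mollify φ u μ) x w‖ₑ ≤ lmollify φ (fun t ↦ ‖g t‖ₑ) μ x * ‖w‖ₑ := by
  rw [fderiv_mollify φ h hx, lmollify, ← lintegral_mul_const' _ _ enorm_ne_top]
  refine (enorm_integral_le_lintegral_enorm _).trans (lintegral_mono fun t ↦ ?_)
  rw [enorm_mul, Real.enorm_of_nonneg (φ.nonneg_normed _), mul_right_comm]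
  gcongr
  rw [← enorm_norm (g t), ← enorm_norm w, ← enorm_mul]
  refine enorm_le_iff_norm_le.2 ?_
  simpa using abs_real_inner_le_norm (g t) w

theorem measurable_lmollify (φ : ContDiffBump (0 : E)) {h : E → ℝ≥0∞} (hh : AEMeasurable h μ) :
    Measurable (lmollify φ h μ) := by
  have : lmollify φ h μ = lmollify φ (hh.mk h) μ := by
    ext x
    exact lintegral_congr_ae (hh.ae_eq_mk.mono fun t ht ↦ by simp only [ht])
  rw [this]
  have := hh.measurable_mk
  have hc := (φ.contDiff_normed (μ := μ) (n := 0)).continuous.measurable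
  refine Measurable.lintegral_prod_right' (f := fun p : E × E ↦
    hh.mk h p.2 * ENNReal.ofReal (φ.normed μ (p.1 - p.2))) ?_
  fun_prop

theorem lintegral_ofReal_normed (φ : ContDiffBump (0 : E)) :
    ∫⁻ x, ENNReal.ofReal (φ.normed μ x) ∂μ = 1 := by
  rw [← ofReal_integral_eq_lintegral_ofReal φ.integrable_normed (.of_forall φ.nonneg_normed),
    φ.integral_normed, ENNReal.ofReal_one]

/-- The normalised bump has mass one, so Cauchy–Schwarz gives the pointwise bound `key`, and Tonelli
integrates it. -/
theorem lintegral_lmollify_sq_le (φ : ContDiffBump (0 : E)) {h : E → ℝ≥0∞}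
    (hh : AEMeasurable h μ) :
    ∫⁻ x, lmollify φ h μ x ^ (2 : ℝ) ∂μ ≤ ∫⁻ x, h x ^ (2 : ℝ) ∂μ := by
  have hc := (φ.contDiff_normed (μ := μ) (n := 0)).continuous.measurable
  have hρ : Measurable fun x ↦ ENNReal.ofReal (φ.normed μ x) := hc.ennreal_ofReal
  have key : ∀ x, lmollify φ h μ x ^ (2 : ℝ) ≤
      ∫⁻ t, h t ^ (2 : ℝ) * ENNReal.ofReal (φ.normed μ (x - t)) ∂μ := by
    intro x
    have hρx : Measurable fun t ↦ ENNReal.ofReal (φ.normed μ (x - t)) :=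
      hρ.comp (measurable_const.sub measurable_id)
    have h1 : lmollify φ h μ x ≤
        (∫⁻ t, h t ^ (2 : ℝ) * ENNReal.ofReal (φ.normed μ (x - t)) ∂μ) ^ (1 / 2 : ℝ) *
        (∫⁻ t, ENNReal.ofReal (φ.normed μ (x - t)) ∂μ) ^ (1 / 2 : ℝ) := by
      refine le_trans (le_of_eq ?_) (ENNReal.lintegral_mul_norm_pow_le
        ((hh.pow_const _).mul hρx.aemeasurable) hρx.aemeasurable (by norm_num) (by norm_num)
        (by norm_num))
      refine lintegral_congr fun t ↦ ?_
      rw [Pi.mul_apply, ENNReal.mul_rpow_of_nonneg _ _ (by norm_num), mul_assoc,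
        ← ENNReal.rpow_add_of_nonneg _ _ (by norm_num) (by norm_num), ← ENNReal.rpow_mul]
      norm_num
    rw [lintegral_sub_left_eq_self (μ := μ) (fun y ↦ ENNReal.ofReal (φ.normed μ y)),
      lintegral_ofReal_normed, ENNReal.one_rpow, mul_one] at h1
    refine (ENNReal.rpow_le_rpow h1 (by norm_num)).trans_eq ?_
    rw [← ENNReal.rpow_mul]
    norm_num
  calc ∫⁻ x, lmollify φ h μ x ^ (2 : ℝ) ∂μ
      ≤ ∫⁻ x, ∫⁻ t, h t ^ (2 : ℝ) * ENNReal.ofReal (φ.normed μ (x - t)) ∂μ ∂μ :=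
        lintegral_mono key
    _ = ∫⁻ t, ∫⁻ x, h t ^ (2 : ℝ) * ENNReal.ofReal (φ.normed μ (x - t)) ∂μ ∂μ := by
        refine lintegral_lintegral_swap ?_
        refine AEMeasurable.mul ((hh.pow_const _).comp_snd) ?_
        exact (hρ.comp (measurable_fst.sub measurable_snd)).aemeasurable
    _ = ∫⁻ t, h t ^ (2 : ℝ) ∂μ := by
        refine lintegral_congr fun t ↦ ?_
        have : Measurable fun x ↦ ENNReal.ofReal (φ.normed μ (x - t)) :=
          hρ.comp (measurable_id.sub_const t)
        rw [lintegral_const_mul _ this,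
          lintegral_sub_right_eq_self (μ := μ) (fun y ↦ ENNReal.ofReal (φ.normed μ y)),
          lintegral_ofReal_normed, mul_one]

end Mollification

theorem exists_contDiffBump_seq {E : Type*} [NormedAddCommGroup E] (ε : ℝ) (hε : 0 < ε) : ∃ φ : ℕ → ContDiffBump (0 : E),
    Filter.Tendsto (fun i ↦ (φ i).rOut) Filter.atTop (nhds 0) ∧
      (∀ i, (φ i).rOut ≤ 2 * (φ i).rIn) ∧ ∀ i, (φ i).rOut ≤ ε := by
  refine ⟨fun i ↦ ⟨ε / (i + 1) / 2, ε / (i + 1), by positivity, half_lt_self (by positivity)⟩,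
    ?_, fun i ↦ ?_, fun i ↦ ?_⟩
  · exact (tendsto_const_div_atTop_nhds_zero_nat ε).comp (Filter.tendsto_add_atTop_nat 1)
      |>.congr fun i ↦ by simp
  · dsimp only; linarith
  · exact div_le_self hε.le (by linarith [(Nat.cast_nonneg i : (0 : ℝ) ≤ i)])

/-! ### Sobolev inequality on sets invariant under half-line translations -/

section LocalSobolev

variable {E ι : Type*} [NormedAddCommGroup E] [InnerProductSpace ℝ E] [FiniteDimensional ℝ E]
  [MeasurableSpace E] [BorelSpace E] [Fintype ι] [Nonempty ι]

theorem exists_sobolev_of_contDiff (μ : Measure E) [μ.IsAddHaarMeasure] (b : Module.Basis ι ℝ E)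
    {q : ℝ} (hq : 2 < q) (hqn : ((Fintype.card ι : ℝ) - 2) * q ≤ 2 * Fintype.card ι) {K : Set E}
    (hK : Bornology.IsBounded K) :
    ∃ C : ℝ≥0∞, C ≠ ⊤ ∧ ∀ (f : E → ℝ) (M : E → ℝ≥0∞) (V : Set E), ContDiff ℝ 1 f →
      Measurable M → MeasurableSet V → (∀ x ∉ K, f x = 0) →
      (∀ x ∈ V, ∀ i, ∀ t : ℝ, t ≤ 0 → x + t • b i ∈ V) →
      (∀ x ∈ V, ∀ w, ‖fderiv ℝ f x w‖ₑ ≤ M x * ‖w‖ₑ) →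
      ∫⁻ x in V, ‖f x‖ₑ ^ q ∂μ ≤ C * (∫⁻ x, M x ^ (2 : ℝ) ∂μ) ^ (q / 2) := by
  set n : ℝ := (Fintype.card ι : ℝ)
  -- With this `γ` the derivative of `|f|^γ` is of size `|f|^(q/2) |∇f|`, whose integral
  -- Cauchy–Schwarz bounds by means of `∫ |f|^q` itself. The exponent `r = q / γ` restores `|f|^q`,
  -- and `(n - 1) r ≤ n` amounts to `hqn`.
  set γ : ℝ := 1 + q / 2 with hγ
  have hγ0 : 0 < γ := by linarith
  set r : ℝ := q / γ with hr
  have hr0 : 0 < r := div_pos (by linarith) hγ0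
  obtain ⟨C₁, hC₁, key⟩ := exists_lintegral_rpow_le_of_le_lintegral_line μ b hr0
    (by rw [hr, hγ, mul_div_assoc', div_le_iff₀ (by linarith)]; linarith)
    hK.measure_lt_top.ne
  set B : ℝ≥0∞ := ∑ i, ‖b i‖ₑ with hB
  have hBt : B ≠ ⊤ := by simp [hB]
  obtain ⟨D, hDB⟩ : ∃ D : ℝ≥0∞, D = ENNReal.ofReal γ * B := ⟨_, rfl⟩
  have hD : D ≠ ⊤ := hDB ▸ ENNReal.mul_ne_top ENNReal.ofReal_ne_top hBt
  refine ⟨(C₁ * D ^ r) ^ γ, ENNReal.rpow_ne_top_of_nonneg hγ0.le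
    (ENNReal.mul_ne_top hC₁ (ENNReal.rpow_ne_top_of_nonneg hr0.le hD)), ?_⟩
  intro f M V hf hM hV hfK hVb hfM
  have hfc : HasCompactSupport f := by
    refine HasCompactSupport.of_support_subset_isCompact hK.isCompact_closure fun x hx ↦ ?_
    by_contra h
    exact hx (hfK x fun h' ↦ h (subset_closure h'))
  have hfm : Measurable fun x ↦ ‖f x‖ₑ := hf.continuous.measurable.enorm
  -- Off `V` the left side vanishes. On `V`, the fundamental theorem of calculus from `-∞` to `0`
  -- uses only points of `V`, by invariance; `γ > 1` makes `|f|^γ` of class `C¹`.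
  have hle : ∀ x i, V.indicator (fun x ↦ ‖f x‖ₑ ^ γ) x ≤
      ∫⁻ t : ℝ, V.indicator (fun x ↦ D * (‖f x‖ₑ ^ (q / 2) * M x)) (x + t • b i) := by
    intro x i
    by_cases hx : x ∈ V
    swap
    · simp [hx]
    rw [Set.indicator_of_mem hx]
    have hc1 : ContDiff ℝ 1 fun t : ℝ ↦ f (x + t • b i) := by fun_prop
    have hs : HasCompactSupport fun t : ℝ ↦ f (x + t • b i) :=
      hfc.comp_isClosedEmbedding ((Homeomorph.addLeft x).isClosedEmbedding.comp
        (isClosedEmbedding_smul_left (b.ne_zero i)))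
    have h0 := HasCompactSupport.enorm_le_lintegral_Ici_deriv
      (hc1.norm_rpow (show 1 < γ by linarith))
      (hs.comp_left (g := fun s : ℝ ↦ ‖s‖ ^ γ) (by simp [hγ0.ne'])) 0
    simp only [zero_smul, add_zero] at h0
    rw [Real.enorm_rpow_of_nonneg (norm_nonneg _) hγ0.le, enorm_norm] at h0
    refine h0.trans ((setLIntegral_mono' measurableSet_Iic fun t ht ↦ ?_).trans
      (setLIntegral_le_lintegral (Set.Iic 0) _))
    have hmem := hVb x hx i t ht
    rw [Set.indicator_of_mem hmem]
    have hd : HasDerivAt (fun t : ℝ ↦ f (x + t • b i)) (fderiv ℝ f (x + t • b i) (b i)) t := by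
      have h1 : HasDerivAt (fun t : ℝ ↦ x + t • b i) (b i) t := by
        simpa using ((hasDerivAt_id t).smul_const (b i)).const_add x
      exact (hf.differentiable one_ne_zero _).hasFDerivAt.comp_hasDerivAt t h1
    have hd2 := (hasDerivAt_abs_rpow (f (x + t • b i)) (show 1 < γ by linarith)).comp t hd
    have hd3 : deriv (fun t : ℝ ↦ ‖f (x + t • b i)‖ ^ γ) t = _ := hd2.deriv
    rw [hd3, enorm_mul, enorm_mul, enorm_mul, Real.enorm_rpow_of_nonneg (abs_nonneg _)
      (by linarith), Real.enorm_abs, Real.enorm_of_nonneg hγ0.le]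
    have e : ‖f (x + t • b i)‖ₑ ^ (γ - 2) * ‖f (x + t • b i)‖ₑ = ‖f (x + t • b i)‖ₑ ^ (q / 2) := by
      nth_rewrite 2 [← ENNReal.rpow_one ‖f (x + t • b i)‖ₑ]
      rw [← ENNReal.rpow_add_of_nonneg _ _ (by linarith) zero_le_one]
      congr 1
      linarith
    rw [mul_assoc (ENNReal.ofReal γ), e]
    calc _ ≤ ENNReal.ofReal γ * ‖f (x + t • b i)‖ₑ ^ (q / 2) * (M (x + t • b i) * B) := by
          gcongr
          refine (hfM _ hmem _).trans ?_
          gcongr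
          exact Finset.single_le_sum (f := fun i ↦ ‖b i‖ₑ) (fun _ _ ↦ zero_le)
            (Finset.mem_univ i)
      _ = _ := by rw [hDB]; ring
  have h1 := key (V.indicator fun x ↦ ‖f x‖ₑ ^ γ)
    (V.indicator fun x ↦ D * (‖f x‖ₑ ^ (q / 2) * M x)) ((hfm.pow_const _).indicator hV)
    (((hfm.pow_const _).mul hM).const_mul D |>.indicator hV)
    (fun x hx ↦ by simp [hfK x hx, hγ0]) hle
  set A := ∫⁻ x in V, ‖f x‖ₑ ^ q ∂μ
  set N := ∫⁻ x, M x ^ (2 : ℝ) ∂μ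
  -- Finiteness allows the power `A ^ (r / 2)` on the right of `h2` to be cancelled; its exponent is
  -- `1 - 1 / γ < 1`.
  have hA : A ≠ ⊤ := by
    have := (hf.continuous.memLp_of_hasCompactSupport (μ := μ) (p := ENNReal.ofReal q) hfc)
    have := lintegral_rpow_enorm_lt_top_of_eLpNorm_lt_top (by simpa using by linarith)
      ENNReal.ofReal_ne_top this.eLpNorm_lt_top
    rw [ENNReal.toReal_ofReal (by linarith)] at this
    exact ((setLIntegral_le_lintegral _ _).trans_lt this).ne
  have e1 : ∫⁻ x, V.indicator (fun x ↦ ‖f x‖ₑ ^ γ) x ^ r ∂μ = A := by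
    simp only [A]
    rw [← lintegral_indicator hV]
    refine lintegral_congr fun x ↦ ?_
    by_cases hx : x ∈ V
    · rw [Set.indicator_of_mem hx, Set.indicator_of_mem hx, ← ENNReal.rpow_mul, hr,
        mul_div_cancel₀ _ hγ0.ne']
    · simp [hx, hr0]
  have e2 : ∫⁻ x, V.indicator (fun x ↦ D * (‖f x‖ₑ ^ (q / 2) * M x)) x ∂μ ≤
      D * (A ^ (1 / 2 : ℝ) * N ^ (1 / 2 : ℝ)) := by
    rw [lintegral_indicator hV, lintegral_const_mul' _ _ hD]
    gcongr
    have : ∫⁻ x in V, ‖f x‖ₑ ^ (q / 2) * M x ∂μ =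
        ∫⁻ x in V, (‖f x‖ₑ ^ q) ^ (1 / 2 : ℝ) * (M x ^ (2 : ℝ)) ^ (1 / 2 : ℝ) ∂μ := by
      congr! 3 with x
      · rw [← ENNReal.rpow_mul]; congr 1; ring
      · rw [← ENNReal.rpow_mul]; norm_num
    rw [this]
    refine (ENNReal.lintegral_mul_norm_pow_le (hfm.pow_const _).aemeasurable
      (hM.pow_const _).aemeasurable (by norm_num) (by norm_num) (by norm_num)).trans ?_
    gcongr
    exact setLIntegral_le_lintegral _ _
  rw [e1] at h1
  have h2 : A ≤ C₁ * D ^ r * N ^ (r / 2) * A ^ (r / 2) := by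
    refine h1.trans ?_
    calc _ ≤ C₁ * (D * (A ^ (1 / 2 : ℝ) * N ^ (1 / 2 : ℝ))) ^ r := by gcongr
      _ = _ := by
        rw [ENNReal.mul_rpow_of_nonneg _ _ hr0.le, ENNReal.mul_rpow_of_nonneg _ _ hr0.le,
          ← ENNReal.rpow_mul, ← ENNReal.rpow_mul]
        ring_nf
  rcases eq_or_ne A 0 with hA0 | hA0
  · rw [hA0]; exact zero_le
  have hs : r / 2 = 1 - 1 / γ := by
    rw [hr, hγ]; field_simp; ring
  have h3 : A ^ (1 / γ) ≤ C₁ * D ^ r * N ^ (r / 2) := by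
    have h4 : A ^ (1 / γ) * A ^ (r / 2) = A := by
      rw [← ENNReal.rpow_add _ _ hA0 hA, hs]; simp
    have h5 : A ^ (r / 2) ≠ 0 := by simp [hA0, hA]
    have h6 : A ^ (r / 2) ≠ ⊤ := ENNReal.rpow_ne_top_of_nonneg (by positivity) hA
    rwa [← ENNReal.mul_le_mul_iff_left h5 h6, h4]
  have h7 := ENNReal.rpow_le_rpow h3 hγ0.le
  rw [← ENNReal.rpow_mul, one_div_mul_cancel hγ0.ne', ENNReal.rpow_one,
    ENNReal.mul_rpow_of_nonneg _ _ hγ0.le, ← ENNReal.rpow_mul] at h7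
  refine h7.trans_eq ?_
  congr 2
  rw [hr]; field_simp

theorem exists_sobolev_of_invariant (μ : Measure E) [μ.IsAddHaarMeasure] (b : Module.Basis ι ℝ E)
    {q : ℝ} (hq : 2 < q) (hqn : ((Fintype.card ι : ℝ) - 2) * q ≤ 2 * Fintype.card ι) {K : Set E}
    (hK : Bornology.IsBounded K) {U : Set E} (hU : IsOpen U)
    (hUb : ∀ x ∈ U, ∀ i, ∀ t : ℝ, t ≤ 0 → x + t • b i ∈ U) :
    ∃ C : ℝ≥0∞, C ≠ ⊤ ∧ ∀ (u : E → ℝ) (g : E → E), HasWeakGradientOn u g U μ →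
      (∀ x ∉ K, u x = 0) →
      ∫⁻ x in U, ‖u x‖ₑ ^ q ∂μ ≤ C * (∫⁻ x, ‖g x‖ₑ ^ (2 : ℝ) ∂μ) ^ (q / 2) := by
  -- Mollifying at radius at most `1` spreads the support by at most `1`, so the thickening by `2`
  -- contains it for every `k`.
  obtain ⟨C, hC, key⟩ := exists_sobolev_of_contDiff μ b hq hqn (hK.thickening (δ := 2))
  obtain ⟨φ, hφ, hφ2, hφ1⟩ := exists_contDiffBump_seq (E := E) 1 one_pos
  refine ⟨C, hC, fun u g h huK ↦ ?_⟩
  -- These are the points whose closed ball of the mollification radius lies in `U`. They inherit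
  -- the invariance of `U`, and each point of `U` belongs to all but finitely many of them.
  let V : ℕ → Set E := fun k ↦ (Metric.cthickening (φ k).rOut Uᶜ)ᶜ
  have hmem : ∀ k x, x ∈ V k ↔ Metric.closedBall x (φ k).rOut ⊆ U := by
    intro k x
    simp only [V, hU.isClosed_compl.cthickening_eq_biUnion_closedBall (φ k).rOut_pos.le,
      Set.mem_compl_iff, Set.mem_iUnion, not_exists, Metric.mem_closedBall]
    refine ⟨fun h y hy ↦ ?_, fun h y hy hxy ↦ hy (h (by rwa [Metric.mem_closedBall, dist_comm]))⟩
    by_contra hyU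
    exact h y hyU (by rwa [dist_comm])
  have hVm : ∀ k, MeasurableSet (V k) :=
    fun k ↦ Metric.isClosed_cthickening.measurableSet.compl
  have hVb : ∀ k, ∀ x ∈ V k, ∀ i, ∀ t : ℝ, t ≤ 0 → x + t • b i ∈ V k := by
    intro k x hx i t ht
    rw [hmem] at hx ⊢
    intro y hy
    have : y - t • b i ∈ U := hx (by
      rw [Metric.mem_closedBall, dist_eq_norm] at hy ⊢
      rwa [sub_right_comm, sub_sub])
    simpa using hUb _ this i t ht
  have hsm : ∀ k, ∫⁻ x in V k, ‖mollify (φ k) u μ x‖ₑ ^ q ∂μ ≤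
      C * (∫⁻ x, ‖g x‖ₑ ^ (2 : ℝ) ∂μ) ^ (q / 2) := by
    intro k
    have hgm := h.integrable_grad.aestronglyMeasurable.enorm
    refine (key _ (lmollify (φ k) (fun t ↦ ‖g t‖ₑ) μ) (V k) (contDiff_mollify _ h.integrable)
      (measurable_lmollify _ hgm) (hVm k) (fun x hx ↦ mollify_eq_zero _ fun y hy ↦ huK y fun hyK ↦
        hx ?_) (hVb k) (fun x hx ↦ enorm_fderiv_mollify_le _ h ((hmem k x).1 hx))).trans ?_
    · rw [Metric.mem_thickening_iff]
      refine ⟨y, hyK, ?_⟩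
      rw [Metric.mem_ball, dist_comm] at hy
      linarith [hφ1 k]
    · exact mul_le_mul_right (ENNReal.rpow_le_rpow (lintegral_lmollify_sq_le _ hgm)
        (by linarith)) _
  calc ∫⁻ x in U, ‖u x‖ₑ ^ q ∂μ
      ≤ ∫⁻ x, Filter.liminf (fun k ↦ (V k).indicator
          (fun x ↦ ‖mollify (φ k) u μ x‖ₑ ^ q) x) Filter.atTop ∂μ := by
        rw [← lintegral_indicator hU.measurableSet]
        refine lintegral_mono_ae ?_
        filter_upwards [ae_tendsto_mollify hφ hφ2 h.integrable] with x hx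
        by_cases hxU : x ∈ U
        swap
        · simp [hxU]
        rw [Set.indicator_of_mem hxU]
        obtain ⟨δ, hδ, hball⟩ := Metric.isOpen_iff.1 hU x hxU
        have hev : ∀ᶠ k in Filter.atTop, x ∈ V k := by
          filter_upwards [hφ.eventually (gt_mem_nhds hδ)] with k hk
          exact (hmem k x).2 ((Metric.closedBall_subset_ball hk).trans hball)
        have ht : Filter.Tendsto (fun k ↦ (V k).indicator
          (fun x ↦ ‖mollify (φ k) u μ x‖ₑ ^ q) x) Filter.atTop (nhds (‖u x‖ₑ ^ q)) := by
          refine Filter.Tendsto.congr' (hev.mono fun k hk ↦ (Set.indicator_of_mem hk _).symm) ?_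
          exact (ENNReal.continuous_rpow_const.tendsto _).comp hx.enorm
        exact ht.liminf_eq.ge
    _ ≤ Filter.liminf (fun k ↦ ∫⁻ x, (V k).indicator
          (fun x ↦ ‖mollify (φ k) u μ x‖ₑ ^ q) x ∂μ) Filter.atTop := by
        refine lintegral_liminf_le fun k ↦ Measurable.indicator ?_ (hVm k)
        exact (contDiff_mollify _ h.integrable).continuous.measurable.enorm.pow_const _
    _ ≤ _ := by
        refine Filter.liminf_le_of_le (by isBoundedDefault) fun c hc ↦ ?_
        obtain ⟨k, hk⟩ := hc.exists
        refine hk.trans ?_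
        rw [lintegral_indicator (hVm k)]
        exact hsm k

end LocalSobolev

/-! ### Local geometry of a `C¹` boundary -/

theorem exists_basis_mem_of_isOpen {E : Type*} [NormedAddCommGroup E] [NormedSpace ℝ E]
    [FiniteDimensional ℝ E] {ι : Type*} (b₀ : Module.Basis ι ℝ E) {S : Set E} (hS : IsOpen S)
    (hne : S.Nonempty) : ∃ b : Module.Basis ι ℝ E, ∀ i, b i ∈ S := by
  have hspan : Submodule.span ℝ S = ⊤ := by
    refine Submodule.eq_top_of_nonempty_interior' _ (hne.mono ?_)
    exact interior_maximal Submodule.subset_span hS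
  let b := Module.Basis.ofSpan hspan.ge
  refine ⟨b.reindex (b.indexEquiv b₀), fun i ↦ ?_⟩
  rw [Module.Basis.reindex_apply]
  exact Module.Basis.ofSpan_subset hspan.ge ⟨_, rfl⟩

open scoped Pointwise in
-- A `C¹` graph is locally Lipschitz, so moving up from a point above it, in a direction steeper
-- than the Lipschitz constant, stays above it. These directions form an open cone, which contains a
-- basis.
theorem exists_isOpen_invariant_of_hasC1Boundary {n : ℕ} {Ω : Set (EuclideanSpace ℝ (Fin n))}
    (hΩ : IsOpen Ω) (hbd : HasC1Boundary Ω) {x₀ : EuclideanSpace ℝ (Fin n)}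
    (hx₀ : x₀ ∈ closure Ω) :
    ∃ r : ℝ, 0 < r ∧ ∃ b : Module.Basis (Fin n) ℝ (EuclideanSpace ℝ (Fin n)),
      ∃ U : Set (EuclideanSpace ℝ (Fin n)), IsOpen U ∧
        (∀ x ∈ U, ∀ i, ∀ t : ℝ, t ≤ 0 → x + t • b i ∈ U) ∧
        U ∩ Metric.ball x₀ r = Ω ∩ Metric.ball x₀ r := by
  let b₀ := (EuclideanSpace.basisFun (Fin n) ℝ).toBasis
  by_cases hx : x₀ ∈ Ω
  · obtain ⟨r, hr, hball⟩ := Metric.isOpen_iff.1 hΩ x₀ hx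
    refine ⟨r, hr, b₀, Set.univ, isOpen_univ, fun _ _ _ _ _ ↦ Set.mem_univ _, ?_⟩
    rw [Set.univ_inter, Set.inter_eq_right.2 hball]
  obtain ⟨r₀, hr₀, ν, hν, γ, hγ, hgraph⟩ := hbd x₀ (by
    rw [frontier, hΩ.interior_eq]; exact ⟨hx₀, hx⟩)
  set P := (Submodule.span ℝ {ν})ᗮ.orthogonalProjectionOnto with hP
  obtain ⟨K, T, hT, hLip⟩ := (hγ.contDiffAt (x := P x₀)).exists_lipschitzOnWith
  obtain ⟨r₁, hr₁, hball⟩ := Metric.mem_nhds_iff.1 hT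
  have hPT : ∀ x ∈ Metric.ball x₀ r₁, P x ∈ T := fun x hx ↦ by
    refine hball ?_
    rw [Metric.mem_ball, dist_eq_norm] at hx ⊢
    rw [← map_sub]
    exact (Submodule.norm_orthogonalProjectionOnto_apply_le _ _).trans_lt hx
  -- The vectors point down, since the translations use `t • b i` with `t ≤ 0`.
  have hS : IsOpen {w : EuclideanSpace ℝ (Fin n) | K * ‖P w‖ < - inner ℝ w ν} :=
    isOpen_lt (by fun_prop) (by fun_prop)
  obtain ⟨b, hb⟩ := exists_basis_mem_of_isOpen b₀ hS ⟨-ν, by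
    have : P ν = 0 := Submodule.orthogonalProjectionOnto_orthogonalComplement_singleton_eq_zero ν
    simp [this, hν]⟩
  let cone : Set (EuclideanSpace ℝ (Fin n)) := {w | ∀ i, b.repr w i ≤ 0}
  have hcone : ∀ w ∈ cone, K * ‖P w‖ ≤ inner ℝ w ν := by
    intro w hw
    have h1 : ‖P w‖ ≤ ∑ i, -b.repr w i * ‖P (b i)‖ := by
      nth_rewrite 1 [← b.sum_repr w]
      rw [map_sum]
      refine (norm_sum_le _ _).trans (Finset.sum_le_sum fun i _ ↦ ?_)
      rw [map_smul, norm_smul, Real.norm_of_nonpos (hw i)]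
    have h2 : inner ℝ w ν = ∑ i, b.repr w i * inner ℝ (b i) ν := by
      nth_rewrite 1 [← b.sum_repr w]
      simp_rw [sum_inner, real_inner_smul_left]
    rw [h2]
    refine (mul_le_mul_of_nonneg_left h1 K.2).trans ?_
    rw [Finset.mul_sum]
    refine Finset.sum_le_sum fun i _ ↦ ?_
    have h3 : K * ‖P (b i)‖ < - inner ℝ (b i) ν := hb i
    have h4 := hw i
    change (K : ℝ) * _ ≤ _
    nlinarith
  set r := min r₀ r₁
  have hrr : Metric.ball x₀ r ⊆ Metric.ball x₀ r₀ := Metric.ball_subset_ball (min_le_left _ _)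
  have hrr' : Metric.ball x₀ r ⊆ Metric.ball x₀ r₁ := Metric.ball_subset_ball (min_le_right _ _)
  -- Adding the cone forces invariance. It creates no new points inside the ball: there the start
  -- and end points both lie in the region of the graph description and of the Lipschitz bound.
  refine ⟨r, lt_min hr₀ hr₁, b, (Ω ∩ Metric.ball x₀ r) + cone,
    (hΩ.inter Metric.isOpen_ball).add_right, ?_, ?_⟩
  · rintro _ ⟨x, hx, w, hw, rfl⟩ i t ht
    refine ⟨x, hx, w + t • b i, fun j ↦ ?_, by simp [add_assoc]⟩
    rw [map_add, map_smul, Finsupp.add_apply, Finsupp.smul_apply, b.repr_self,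
      Finsupp.single_apply]
    have := hw j
    split_ifs <;> simp <;> linarith
  · refine Set.Subset.antisymm ?_ ?_
    · rintro _ ⟨⟨x, ⟨hxΩ, hxr⟩, w, hw, rfl⟩, hb⟩
      refine ⟨?_, hb⟩
      simp only at hb ⊢
      rw [hgraph _ (hrr hb)]
      have h1 := (hgraph _ (hrr hxr)).1 hxΩ
      have h2 := hLip.dist_le_mul _ (hPT _ (hrr' hb)) _ (hPT _ (hrr' hxr))
      rw [dist_eq_norm, dist_eq_norm, map_add, add_sub_cancel_left] at h2
      have h3 := hcone w hw
      have h4 := Real.le_norm_self (γ (P x + P w) - γ (P x))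
      rw [inner_add_left, map_add]
      linarith
    · rintro x ⟨hx, hr⟩
      exact ⟨⟨x, ⟨hx, hr⟩, 0, fun i ↦ by simp, by simp⟩, hr⟩

/-! ### Cutoffs and extension by zero -/

theorem integrable_mul_fderiv {E : Type*} [NormedAddCommGroup E] [InnerProductSpace ℝ E]
    [MeasurableSpace E] [BorelSpace E] {μ : Measure E} {u χ : E → ℝ} (hu : Integrable u μ) (hχ : ContDiff ℝ ∞ χ)
    (hχc : HasCompactSupport χ) (w : E) : Integrable (fun x ↦ u x * fderiv ℝ χ x w) μ := by
  have hc : Continuous fun x ↦ fderiv ℝ χ x w :=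
    (hχ.continuous_fderiv (by simp)).clm_apply continuous_const
  obtain ⟨C, hC⟩ := (hχc.fderiv_apply ℝ w).exists_bound_of_continuous hc
  exact hu.mul_bdd hc.aestronglyMeasurable (.of_forall hC)

section Cutoff

variable {E : Type*} [NormedAddCommGroup E] [InnerProductSpace ℝ E] [FiniteDimensional ℝ E]
  [MeasurableSpace E] [BorelSpace E] {μ : Measure E}

/-- For a test function `φ` on `U`, the product `χ φ` is a test function on `V`, even when `U` is
not contained in `V`. This moves a weak gradient from `Ω` to the local model `U`. -/
theorem HasWeakGradientOn.mul_cutoff {u χ : E → ℝ} {g : E → E} {U V : Set E}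
    (h : HasWeakGradientOn u g V μ) (hχ : ContDiff ℝ ∞ χ) (hχc : HasCompactSupport χ)
    (hUV : tsupport χ ∩ U ⊆ V) :
    HasWeakGradientOn (fun x ↦ u x * χ x)
      (fun x ↦ χ x • g x + u x • (InnerProductSpace.toDual ℝ E).symm (fderiv ℝ χ x)) U μ := by
  obtain ⟨C, hC⟩ := hχc.exists_bound_of_continuous hχ.continuous
  have hfc : Continuous fun x ↦ (InnerProductSpace.toDual ℝ E).symm (fderiv ℝ χ x) :=
    (LinearIsometryEquiv.continuous _).comp (hχ.continuous_fderiv (by simp))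
  obtain ⟨C', hC'⟩ := (hχc.fderiv ℝ).exists_bound_of_continuous
    (hχ.continuous_fderiv (by simp))
  have hu := h.integrable.mul_bdd hχ.continuous.aestronglyMeasurable (.of_forall hC)
  have hg := h.integrable_grad.bdd_smul C hχ.continuous.aestronglyMeasurable (.of_forall hC)
  have hd := h.integrable.smul_bdd C' hfc.aestronglyMeasurable
    (.of_forall fun x ↦ by simpa using hC' x)
  refine ⟨hu, hg.add hd, fun φ hφ hφc hφU w ↦ ?_⟩
  have key := h.integral_eq (fun x ↦ χ x * φ x) (hχ.mul hφ) hχc.mul_right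
    ((Set.subset_inter (tsupport_mul_subset_left) ((tsupport_mul_subset_right).trans hφU)).trans
      hUV) w
  have e1 : ∀ x, u x * fderiv ℝ (fun x ↦ χ x * φ x) x w =
      u x * χ x * fderiv ℝ φ x w + u x * fderiv ℝ χ x w * φ x := by
    intro x
    rw [fderiv_fun_mul (hχ.differentiable (by simp) x) (hφ.differentiable (by simp) x)]
    simp
    ring
  obtain ⟨D, hD⟩ := hφc.exists_bound_of_continuous hφ.continuous
  have i1 := integrable_mul_fderiv hu hφ hφc w
  have i2 := (integrable_mul_fderiv h.integrable hχ hχc w).mul_bdd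
    hφ.continuous.aestronglyMeasurable (.of_forall hD)
  have i3 : Integrable (fun x ↦ inner ℝ (g x) w * (χ x * φ x)) μ := by
    have := (hg.inner_const (𝕜 := ℝ) w).mul_bdd hφ.continuous.aestronglyMeasurable (.of_forall hD)
    refine this.congr (.of_forall fun x ↦ ?_)
    simp [real_inner_smul_left]
    ring
  simp_rw [e1] at key
  rw [integral_add i1 i2] at key
  have e2 : ∀ x, inner ℝ (χ x • g x + u x • (InnerProductSpace.toDual ℝ E).symm (fderiv ℝ χ x)) w
      * φ x = inner ℝ (g x) w * (χ x * φ x) + u x * fderiv ℝ χ x w * φ x := by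
    intro x
    rw [inner_add_left, real_inner_smul_left, real_inner_smul_left,
      InnerProductSpace.toDual_symm_apply]
    ring
  simp_rw [e2]
  rw [integral_add i3 i2]
  linarith

end Cutoff

theorem IsWeakGradient.hasWeakGradientOn {n : ℕ} {Ω : Set (EuclideanSpace ℝ (Fin n))}
    {R : EuclideanSpace ℝ (Fin n) → ℝ} {G : EuclideanSpace ℝ (Fin n) → EuclideanSpace ℝ (Fin n)}
    (h : IsWeakGradient Ω R G) (hΩ : MeasurableSet Ω) (hR : IntegrableOn R Ω volume)
    (hG : IntegrableOn G Ω volume) :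
    HasWeakGradientOn (Ω.indicator R) (Ω.indicator G) Ω volume := by
  refine ⟨hR.integrable_indicator hΩ, hG.integrable_indicator hΩ, fun φ hφ hφc hφΩ w ↦ ?_⟩
  have e1 : ∀ x, Ω.indicator R x * fderiv ℝ φ x w =
      Ω.indicator (fun x ↦ ∑ i, w i * (R x * fderiv ℝ φ x (EuclideanSpace.single i 1))) x := by
    intro x
    by_cases hx : x ∈ Ω
    · rw [Set.indicator_of_mem hx, Set.indicator_of_mem hx]
      have hw : w = ∑ i, w i • EuclideanSpace.single i (1 : ℝ) := by
        ext j; simp [Finset.sum_apply, Pi.single_apply]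
      nth_rewrite 1 [hw]
      rw [map_sum, Finset.mul_sum]
      refine Finset.sum_congr rfl fun i _ ↦ ?_
      rw [map_smul, smul_eq_mul]
      ring
    · simp [hx]
  have e2 : ∀ x, inner ℝ (Ω.indicator G x) w * φ x =
      Ω.indicator (fun x ↦ ∑ i, w i * (G x i * φ x)) x := by
    intro x
    by_cases hx : x ∈ Ω
    · rw [Set.indicator_of_mem hx, Set.indicator_of_mem hx, PiLp.inner_apply, Finset.sum_mul]
      refine Finset.sum_congr rfl fun i _ ↦ ?_
      simp
      ring
    · simp [hx]
  simp_rw [e1, e2]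
  obtain ⟨D, hD⟩ := hφc.exists_bound_of_continuous hφ.continuous
  rw [integral_indicator hΩ, integral_indicator hΩ, integral_finsetSum, integral_finsetSum,
    ← Finset.sum_neg_distrib]
  · refine Finset.sum_congr rfl fun i _ ↦ ?_
    rw [integral_const_mul, integral_const_mul, h.integral_eq φ hφ hφc hφΩ i, mul_neg]
  · intro i _
    refine (Integrable.mul_bdd (c := D) ?_ hφ.continuous.aestronglyMeasurable
      (.of_forall hD)).const_mul _
    exact (EuclideanSpace.proj (𝕜 := ℝ) i).integrable_comp hG
  · exact fun i _ ↦ (integrable_mul_fderiv hR hφ hφc _).const_mul _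

/-! ### Sobolev inequality on `Ω` -/

theorem ENNReal.add_sq_le (a b : ℝ≥0∞) :
    (a + b) ^ (2 : ℝ) ≤ 2 * (a ^ (2 : ℝ) + b ^ (2 : ℝ)) := by
  have := ENNReal.rpow_add_le_mul_rpow_add_rpow a b (p := 2) (by norm_num)
  norm_num at this ⊢
  exact this

/-- `R` and `G` are square integrable on `Ω`, and `G` is a weak gradient of `R`. -/
structure IsH1Pair {n : ℕ} (Ω : Set (EuclideanSpace ℝ (Fin n)))
    (R : EuclideanSpace ℝ (Fin n) → ℝ) (G : EuclideanSpace ℝ (Fin n) → EuclideanSpace ℝ (Fin n)) :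
    Prop where
  weak : IsWeakGradient Ω R G
  memLp : MemLp R 2 (volume.restrict Ω)
  memLp_grad : MemLp G 2 (volume.restrict Ω)

section

variable {n : ℕ} {Ω : Set (EuclideanSpace ℝ (Fin n))}

theorem IsH1Pair.hasWeakGradientOn {R : EuclideanSpace ℝ (Fin n) → ℝ}
    {G : EuclideanSpace ℝ (Fin n) → EuclideanSpace ℝ (Fin n)} (h : IsH1Pair Ω R G)
    (hΩ : IsOpen Ω) (hb : Bornology.IsBounded Ω) :
    HasWeakGradientOn (Ω.indicator R) (Ω.indicator G) Ω volume := by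
  have : IsFiniteMeasure (volume.restrict Ω) := isFiniteMeasure_restrict.2 hb.measure_lt_top.ne
  exact h.weak.hasWeakGradientOn hΩ.measurableSet (h.memLp.integrable (by norm_num))
    (h.memLp_grad.integrable (by norm_num))

theorem exists_sobolev_near (hn : 1 ≤ n) (hΩ : IsOpen Ω) (hb : Bornology.IsBounded Ω)
    (hbd : HasC1Boundary Ω) {q : ℝ} (hq : 2 < q) (hqn : ((n : ℝ) - 2) * q ≤ 2 * n)
    {x₀ : EuclideanSpace ℝ (Fin n)} (hx₀ : x₀ ∈ closure Ω) :
    ∃ ρ : ℝ, 0 < ρ ∧ ∃ C : ℝ≥0∞, C ≠ ⊤ ∧ ∀ R G, IsH1Pair Ω R G →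
      ∫⁻ x in Ω ∩ Metric.ball x₀ ρ, ‖R x‖ₑ ^ q ≤
        C * ((∫⁻ x in Ω, ‖R x‖ₑ ^ (2 : ℝ)) + ∫⁻ x in Ω, ‖G x‖ₑ ^ (2 : ℝ)) ^ (q / 2) := by
  have : Nonempty (Fin n) := ⟨⟨0, hn⟩⟩
  obtain ⟨r, hr, b, U, hU, hUb, hUr⟩ := exists_isOpen_invariant_of_hasC1Boundary hΩ hbd hx₀
  let χ : ContDiffBump x₀ := ⟨r / 4, r / 2, by positivity, by linarith⟩
  have hts : tsupport χ ⊆ Metric.ball x₀ r := by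
    rw [χ.tsupport_eq]
    exact Metric.closedBall_subset_ball (by change r / 2 < r; linarith)
  obtain ⟨C, hC, key⟩ := exists_sobolev_of_invariant volume b hq (by simpa using hqn)
    (Metric.isBounded_ball (x := x₀) (r := r)) hU hUb
  obtain ⟨L, hL⟩ := (χ.hasCompactSupport.fderiv ℝ).exists_bound_of_continuous
    ((χ.contDiff (n := 1)).continuous_fderiv one_ne_zero)
  have hLe : ∀ x, ‖fderiv ℝ χ x‖ₑ ≤ ENNReal.ofReal L := fun x ↦ by
    rw [← ofReal_norm]; exact ENNReal.ofReal_le_ofReal (hL x)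
  set D : ℝ≥0∞ := 2 * (1 + ENNReal.ofReal L ^ (2 : ℝ)) with hD
  have hDt : D ≠ ⊤ := ENNReal.mul_ne_top (by simp) (by simp)
  refine ⟨r / 4, by positivity, C * D ^ (q / 2), ENNReal.mul_ne_top hC
    (ENNReal.rpow_ne_top_of_nonneg (by linarith) hDt), fun R G h ↦ ?_⟩
  have hw := h.hasWeakGradientOn hΩ hb
  have hcut := hw.mul_cutoff χ.contDiff χ.hasCompactSupport (U := U) (by
    rintro x ⟨hx, hxU⟩
    exact (hUr.subset ⟨hxU, hts hx⟩).1)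
  have h1 := key _ _ hcut fun x hx ↦ by
    have : χ x = 0 := image_eq_zero_of_notMem_tsupport fun h ↦ hx (hts h)
    simp [this]
  have hχ1 : ∀ x, ‖χ x‖ₑ ≤ 1 := fun x ↦ by
    rw [Real.enorm_of_nonneg χ.nonneg]
    exact ENNReal.ofReal_le_one.2 χ.le_one
  have hae := hw.integrable.aestronglyMeasurable.enorm
  have haeg := hw.integrable_grad.aestronglyMeasurable.enorm
  have hind : ∀ {F : Type} [NormedAddCommGroup F] (f : EuclideanSpace ℝ (Fin n) → F),
      ∫⁻ x, ‖Ω.indicator f x‖ₑ ^ (2 : ℝ) = ∫⁻ x in Ω, ‖f x‖ₑ ^ (2 : ℝ) := by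
    intro F _ f
    rw [← lintegral_indicator hΩ.measurableSet]
    refine lintegral_congr fun x ↦ ?_
    by_cases hx : x ∈ Ω <;> simp [hx]
  calc ∫⁻ x in Ω ∩ Metric.ball x₀ (r / 4), ‖R x‖ₑ ^ q
      ≤ ∫⁻ x in U, ‖Ω.indicator R x * χ x‖ₑ ^ q := by
        have hsub : Ω ∩ Metric.ball x₀ (r / 4) ⊆ U := fun x hx ↦
          (hUr.superset ⟨hx.1, Metric.ball_subset_ball (by linarith) hx.2⟩).1
        refine le_trans (le_of_eq ?_) (lintegral_mono_set hsub)
        refine setLIntegral_congr_fun (hΩ.measurableSet.inter measurableSet_ball) fun x hx ↦ ?_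
        have : χ x = 1 := χ.one_of_mem_closedBall (Metric.ball_subset_closedBall hx.2)
        simp [this, hx.1]
    _ ≤ C * (D * ((∫⁻ x in Ω, ‖R x‖ₑ ^ (2 : ℝ)) + ∫⁻ x in Ω, ‖G x‖ₑ ^ (2 : ℝ))) ^ (q / 2) := by
        refine h1.trans (mul_le_mul_right (ENNReal.rpow_le_rpow ?_ (by linarith)) _)
        calc _ ≤ ∫⁻ x, 2 * (‖Ω.indicator G x‖ₑ ^ (2 : ℝ) +
              ENNReal.ofReal L ^ (2 : ℝ) * ‖Ω.indicator R x‖ₑ ^ (2 : ℝ)) := by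
              refine lintegral_mono fun x ↦ ?_
              rw [mul_comm (ENNReal.ofReal L ^ (2 : ℝ)),
                ← ENNReal.mul_rpow_of_nonneg _ _ (by norm_num : (0 : ℝ) ≤ 2)]
              refine le_trans (ENNReal.rpow_le_rpow ?_ (by norm_num)) (ENNReal.add_sq_le _ _)
              refine (enorm_add_le _ _).trans (add_le_add ?_ ?_)
              · rw [enorm_smul]
                exact mul_le_of_le_one_left' (hχ1 x)
              · rw [enorm_smul, LinearIsometryEquiv.enorm_map]
                exact mul_le_mul_right (hLe x) _
          _ = 2 * ((∫⁻ x in Ω, ‖G x‖ₑ ^ (2 : ℝ)) +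
              ENNReal.ofReal L ^ (2 : ℝ) * ∫⁻ x in Ω, ‖R x‖ₑ ^ (2 : ℝ)) := by
              rw [lintegral_const_mul' _ _ (by simp), lintegral_add_left' (haeg.pow_const _),
                lintegral_const_mul' _ _ (by simp), hind, hind]
          _ ≤ _ := by
              rw [hD, mul_assoc]
              gcongr
              rw [mul_add, add_comm]
              gcongr
              · exact le_add_self
              · exact le_mul_of_one_le_left' le_self_add
    _ = _ := by rw [ENNReal.mul_rpow_of_nonneg _ _ (by linarith), mul_assoc]

/-- The Sobolev inequality on a bounded open set with `C¹` boundary. -/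
theorem exists_sobolev (hn : 1 ≤ n) (hΩ : IsOpen Ω) (hb : Bornology.IsBounded Ω)
    (hbd : HasC1Boundary Ω) {q : ℝ} (hq : 2 < q) (hqn : ((n : ℝ) - 2) * q ≤ 2 * n) :
    ∃ C : ℝ≥0∞, C ≠ ⊤ ∧ ∀ R G, IsH1Pair Ω R G →
      ∫⁻ x in Ω, ‖R x‖ₑ ^ q ≤
        C * ((∫⁻ x in Ω, ‖R x‖ₑ ^ (2 : ℝ)) + ∫⁻ x in Ω, ‖G x‖ₑ ^ (2 : ℝ)) ^ (q / 2) := by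
  have key : ∃ C : ℝ≥0∞, C ≠ ⊤ ∧ ∀ R G, IsH1Pair Ω R G →
      ∫⁻ x in Ω ∩ closure Ω, ‖R x‖ₑ ^ q ≤
        C * ((∫⁻ x in Ω, ‖R x‖ₑ ^ (2 : ℝ)) + ∫⁻ x in Ω, ‖G x‖ₑ ^ (2 : ℝ)) ^ (q / 2) := by
    -- The property passes to subsets and finite unions and holds near each point of `closure Ω`, so
    -- compactness gives it for the whole closure.
    refine hb.isCompact_closure.induction_on (p := fun s ↦ ∃ C : ℝ≥0∞, C ≠ ⊤ ∧
      ∀ R G, IsH1Pair Ω R G → ∫⁻ x in Ω ∩ s, ‖R x‖ₑ ^ q ≤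
        C * ((∫⁻ x in Ω, ‖R x‖ₑ ^ (2 : ℝ)) + ∫⁻ x in Ω, ‖G x‖ₑ ^ (2 : ℝ)) ^ (q / 2)) ?_ ?_ ?_ ?_
    · exact ⟨0, by simp, by simp⟩
    · rintro s t hst ⟨C, hC, h⟩
      exact ⟨C, hC, fun R G hRG ↦
        (lintegral_mono_set (Set.inter_subset_inter_right _ hst)).trans (h R G hRG)⟩
    · rintro s t ⟨C, hC, h⟩ ⟨C', hC', h'⟩
      refine ⟨C + C', ENNReal.add_ne_top.2 ⟨hC, hC'⟩, fun R G hRG ↦ ?_⟩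
      rw [Set.inter_union_distrib_left, add_mul]
      exact (lintegral_union_le _ _ _).trans (add_le_add (h R G hRG) (h' R G hRG))
    · intro x hx
      obtain ⟨ρ, hρ, C, hC, h⟩ := exists_sobolev_near hn hΩ hb hbd hq hqn hx
      exact ⟨_, mem_nhdsWithin_of_mem_nhds (Metric.ball_mem_nhds x hρ), C, hC, h⟩
  rwa [Set.inter_eq_left.2 subset_closure] at key

end

/-! ### Poincaré inequality away from the boundary -/

theorem lintegral_rpow_two_le {α : Type*} [MeasurableSpace α] {ν : Measure α}
    [IsProbabilityMeasure ν] {f : α → ℝ≥0∞} (hf : AEMeasurable f ν) :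
    (∫⁻ x, f x ∂ν) ^ (2 : ℝ) ≤ ∫⁻ x, f x ^ (2 : ℝ) ∂ν := by
  have h := lintegral_rpow_le_of_support (μ := ν) one_pos (one_le_two (α := ℝ)) (K := Set.univ) hf
    (by simp)
  simp only [ENNReal.rpow_one, measure_univ, ENNReal.one_rpow, one_mul] at h
  refine (ENNReal.rpow_le_rpow h (by norm_num)).trans_eq ?_
  rw [← ENNReal.rpow_mul]
  norm_num


theorem enorm_sub_rpow_two_le {E : Type*} [NormedAddCommGroup E] [NormedSpace ℝ E]
    [MeasurableSpace E] [BorelSpace E] {f : E → ℝ} {M : E → ℝ≥0∞} (hf : ContDiff ℝ 1 f) (hM : Measurable M)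
    {x h : E} (hfM : ∀ t ∈ Set.Icc (0 : ℝ) 1, ∀ w,
      ‖fderiv ℝ f (x + t • h) w‖ₑ ≤ M (x + t • h) * ‖w‖ₑ) :
    ‖f (x + h) - f x‖ₑ ^ (2 : ℝ) ≤
      ‖h‖ₑ ^ (2 : ℝ) * ∫⁻ t in Set.Icc (0 : ℝ) 1, M (x + t • h) ^ (2 : ℝ) := by
  have hc : ContDiff ℝ 1 fun t : ℝ ↦ f (x + t • h) := by fun_prop
  have h1 := enorm_sub_le_lintegral_deriv_of_contDiffOn_Icc hc.contDiffOn zero_le_one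
  simp only [one_smul, zero_smul, add_zero] at h1
  have h2 : ∫⁻ t in Set.Icc (0 : ℝ) 1, ‖deriv (fun t : ℝ ↦ f (x + t • h)) t‖ₑ ≤
      (∫⁻ t in Set.Icc (0 : ℝ) 1, M (x + t • h)) * ‖h‖ₑ := by
    rw [← lintegral_mul_const' _ _ enorm_ne_top]
    refine setLIntegral_mono' measurableSet_Icc fun t ht ↦ ?_
    have hd : HasDerivAt (fun t : ℝ ↦ f (x + t • h)) (fderiv ℝ f (x + t • h) h) t := by
      have h1 : HasDerivAt (fun t : ℝ ↦ x + t • h) h t := by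
        simpa using ((hasDerivAt_id t).smul_const h).const_add x
      exact (hf.differentiable one_ne_zero _).hasFDerivAt.comp_hasDerivAt t h1
    rw [hd.deriv]
    exact hfM t ht h
  refine (ENNReal.rpow_le_rpow (h1.trans h2) (by norm_num)).trans ?_
  rw [ENNReal.mul_rpow_of_nonneg _ _ (by norm_num), mul_comm]
  have : IsProbabilityMeasure (volume.restrict (Set.Icc (0 : ℝ) 1)) := ⟨by simp⟩
  refine mul_le_mul_right (lintegral_rpow_two_le (Measurable.aemeasurable ?_)) _
  fun_prop

/-- Writing `y = x + h` with `‖h‖ < 2 * r`, the difference is an integral along a segment inside the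
convex ball. Once the integral in `x` is extended to the whole space and taken first, translation
invariance removes `t • h`. -/
theorem lintegral_ball_ball_enorm_sub_le {E : Type*} [NormedAddCommGroup E] [NormedSpace ℝ E]
    [FiniteDimensional ℝ E] [MeasurableSpace E] [BorelSpace E] {μ : Measure E}
    [μ.IsAddHaarMeasure] {f : E → ℝ} {M : E → ℝ≥0∞} (hf : ContDiff ℝ 1 f)
    (hM : Measurable M) {x₀ : E} {r : ℝ}
    (hfM : ∀ x ∈ Metric.ball x₀ r, ∀ w, ‖fderiv ℝ f x w‖ₑ ≤ M x * ‖w‖ₑ) :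
    ∫⁻ x in Metric.ball x₀ r, ∫⁻ y in Metric.ball x₀ r, ‖f y - f x‖ₑ ^ (2 : ℝ) ∂μ ∂μ ≤
      μ (Metric.ball (0 : E) (2 * r)) * ENNReal.ofReal (2 * r) ^ (2 : ℝ) *
        ∫⁻ x, M x ^ (2 : ℝ) ∂μ := by
  set B := Metric.ball x₀ r
  set B' := Metric.ball (0 : E) (2 * r)
  set D := ENNReal.ofReal (2 * r) ^ (2 : ℝ)
  have hMm : Measurable fun p : (E × E) × ℝ ↦ M (p.1.1 + p.2 • p.1.2) ^ (2 : ℝ) := by fun_prop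
  have hMm' : Measurable fun p : E × E ↦
      D * ∫⁻ t in Set.Icc (0 : ℝ) 1, M (p.1 + t • p.2) ^ (2 : ℝ) :=
    (hMm.lintegral_prod_right' (ν := volume.restrict (Set.Icc (0 : ℝ) 1))).const_mul _
  have key : ∀ x ∈ B, ∫⁻ y in B, ‖f y - f x‖ₑ ^ (2 : ℝ) ∂μ ≤
      ∫⁻ h in B', D * (∫⁻ t in Set.Icc (0 : ℝ) 1, M (x + t • h) ^ (2 : ℝ)) ∂μ := by
    intro x hx
    rw [← lintegral_indicator measurableSet_ball, ← lintegral_indicator measurableSet_ball,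
      ← lintegral_add_left_eq_self _ x]
    refine lintegral_mono fun h ↦ ?_
    by_cases hB : x + h ∈ B
    swap
    · rw [Set.indicator_of_notMem hB]
      exact zero_le
    have hh : ‖h‖ < 2 * r := by
      have h1 := dist_triangle_right (x + h) x x₀
      rw [Metric.mem_ball] at hx hB
      rw [dist_eq_norm, add_sub_cancel_left] at h1
      linarith
    rw [Set.indicator_of_mem hB, Set.indicator_of_mem (by simpa [B'] using hh)]
    refine (enorm_sub_rpow_two_le hf hM fun t ht w ↦ hfM _ ?_ w).trans ?_
    · exact (convex_ball x₀ r).add_smul_mem hx hB ht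
    · gcongr
      rw [← ofReal_norm]
      exact ENNReal.rpow_le_rpow (ENNReal.ofReal_le_ofReal hh.le) (by norm_num)
  calc _ ≤ ∫⁻ x in B, ∫⁻ h in B', D * (∫⁻ t in Set.Icc (0 : ℝ) 1, M (x + t • h) ^ (2 : ℝ)) ∂μ ∂μ :=
        setLIntegral_mono' measurableSet_ball key
    _ ≤ ∫⁻ x, ∫⁻ h in B', D * (∫⁻ t in Set.Icc (0 : ℝ) 1, M (x + t • h) ^ (2 : ℝ)) ∂μ ∂μ :=
        setLIntegral_le_lintegral _ _
    _ = ∫⁻ h in B', ∫⁻ x, D * (∫⁻ t in Set.Icc (0 : ℝ) 1, M (x + t • h) ^ (2 : ℝ)) ∂μ ∂μ :=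
        lintegral_lintegral_swap hMm'.aemeasurable
    _ = ∫⁻ _ in B', D * ∫⁻ x, M x ^ (2 : ℝ) ∂μ ∂μ := by
        refine lintegral_congr fun h ↦ ?_
        rw [lintegral_const_mul' _ _
          (ENNReal.rpow_ne_top_of_nonneg (by norm_num) ENNReal.ofReal_ne_top)]
        have hm : Measurable fun p : E × ℝ ↦ M (p.1 + p.2 • h) ^ (2 : ℝ) := by fun_prop
        rw [lintegral_lintegral_swap (μ := μ) (ν := volume.restrict (Set.Icc (0 : ℝ) 1))
          (f := fun x t ↦ M (x + t • h) ^ (2 : ℝ)) hm.aemeasurable]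
        simp_rw [lintegral_add_right_eq_self (μ := μ) (fun x ↦ M x ^ (2 : ℝ))]
        rw [setLIntegral_const, Real.volume_Icc, sub_zero, ENNReal.ofReal_one, mul_one]
    _ = _ := by rw [setLIntegral_const]; ring

theorem lintegral_lintegral_enorm_sub_le_of_tendsto {α : Type*} [MeasurableSpace α]
    {ν : Measure α} [SFinite ν] {f : ℕ → α → ℝ} {u : α → ℝ} (hf : ∀ k, Measurable (f k))
    (hlim : ∀ᵐ x ∂ν, Filter.Tendsto (fun k ↦ f k x) Filter.atTop (nhds (u x))) {C : ℝ≥0∞}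
    (h : ∀ k, ∫⁻ x, ∫⁻ y, ‖f k y - f k x‖ₑ ^ (2 : ℝ) ∂ν ∂ν ≤ C) :
    ∫⁻ x, ∫⁻ y, ‖u y - u x‖ₑ ^ (2 : ℝ) ∂ν ∂ν ≤ C := by
  have hmeas : ∀ k, Measurable fun p : α × α ↦ ‖f k p.2 - f k p.1‖ₑ ^ (2 : ℝ) := by
    intro k
    have := hf k
    fun_prop
  calc ∫⁻ x, ∫⁻ y, ‖u y - u x‖ₑ ^ (2 : ℝ) ∂ν ∂ν
      ≤ ∫⁻ x, Filter.liminf (fun k ↦ ∫⁻ y, ‖f k y - f k x‖ₑ ^ (2 : ℝ) ∂ν) Filter.atTop ∂ν := by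
        refine lintegral_mono_ae ?_
        filter_upwards [hlim] with x hx
        refine le_trans (lintegral_mono_ae ?_) (lintegral_liminf_le
          fun k ↦ (hmeas k).comp measurable_prodMk_left)
        filter_upwards [hlim] with y hy
        have := (ENNReal.continuous_rpow_const (y := 2)).tendsto _ |>.comp (hy.sub hx).enorm
        exact this.liminf_eq.ge
    _ ≤ Filter.liminf (fun k ↦ ∫⁻ x, ∫⁻ y, ‖f k y - f k x‖ₑ ^ (2 : ℝ) ∂ν ∂ν) Filter.atTop :=
        lintegral_liminf_le fun k ↦ (hmeas k).lintegral_prod_right'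
    _ ≤ C := by
        refine Filter.liminf_le_of_le (by isBoundedDefault) fun c hc ↦ ?_
        obtain ⟨k, hk⟩ := hc.exists
        exact hk.trans (h k)

/-- A Poincaré inequality on `S`, with the gradient integrated over `Ω`. -/
def PoincareOn {n : ℕ} (Ω S : Set (EuclideanSpace ℝ (Fin n))) : Prop :=
  ∃ C : ℝ≥0∞, C ≠ ⊤ ∧ ∀ R G, IsH1Pair Ω R G → ∃ c : ℝ,
    ∫⁻ x in S, ‖R x - c‖ₑ ^ (2 : ℝ) ≤ C * ∫⁻ x in Ω, ‖G x‖ₑ ^ (2 : ℝ)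

section

variable {n : ℕ} {Ω S T : Set (EuclideanSpace ℝ (Fin n))}

theorem poincareOn_ball (hΩ : IsOpen Ω) (hb : Bornology.IsBounded Ω)
    {x₀ : EuclideanSpace ℝ (Fin n)} {r : ℝ} (hr : 0 < r) (hball : Metric.ball x₀ (2 * r) ⊆ Ω) :
    PoincareOn Ω (Metric.ball x₀ r) := by
  set B := Metric.ball x₀ r
  have hBΩ : B ⊆ Ω := (Metric.ball_subset_ball (by linarith)).trans hball
  set D := volume (Metric.ball (0 : EuclideanSpace ℝ (Fin n)) (2 * r)) *
    ENNReal.ofReal (2 * r) ^ (2 : ℝ)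
  have hD : D ≠ ⊤ := ENNReal.mul_ne_top measure_ball_lt_top.ne
    (ENNReal.rpow_ne_top_of_nonneg (by norm_num) ENNReal.ofReal_ne_top)
  have hB0 : volume B ≠ 0 := (Metric.measure_ball_pos _ _ hr).ne'
  refine ⟨(volume B)⁻¹ * D, ENNReal.mul_ne_top (by simpa using hB0) hD, fun R G h ↦ ?_⟩
  have hw := h.hasWeakGradientOn hΩ hb
  obtain ⟨φ, hφ, hφ2, hφr⟩ := exists_contDiffBump_seq (E := EuclideanSpace ℝ (Fin n)) r hr
  set u := Ω.indicator R
  set f : ℕ → EuclideanSpace ℝ (Fin n) → ℝ := fun k ↦ mollify (φ k) u volume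
  have hfc : ∀ k, ContDiff ℝ 1 (f k) := fun k ↦ contDiff_mollify _ hw.integrable
  have hgm := hw.integrable_grad.aestronglyMeasurable.enorm
  have hN : ∫⁻ x, ‖Ω.indicator G x‖ₑ ^ (2 : ℝ) = ∫⁻ x in Ω, ‖G x‖ₑ ^ (2 : ℝ) := by
    rw [← lintegral_indicator hΩ.measurableSet]
    refine lintegral_congr fun x ↦ ?_
    by_cases hx : x ∈ Ω <;> simp [hx]
  have hsm : ∀ k, ∫⁻ x in B, ∫⁻ y in B, ‖f k y - f k x‖ₑ ^ (2 : ℝ) ≤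
      D * ∫⁻ x in Ω, ‖G x‖ₑ ^ (2 : ℝ) := by
    intro k
    refine (lintegral_ball_ball_enorm_sub_le (hfc k) (measurable_lmollify (φ k) hgm)
      fun x hx w ↦ enorm_fderiv_mollify_le _ hw ?_ w).trans ?_
    · refine (Metric.closedBall_subset_ball' ?_).trans hball
      have := hφr k
      rw [Metric.mem_ball] at hx
      linarith
    · rw [← hN]
      exact mul_le_mul_right (lintegral_lmollify_sq_le _ hgm) _
  have hlim := ae_restrict_of_ae (s := B) (ae_tendsto_mollify (μ := volume) hφ hφ2 hw.integrable)
  have hdouble : ∫⁻ x in B, ∫⁻ y in B, ‖u y - u x‖ₑ ^ (2 : ℝ) ≤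
      D * ∫⁻ x in Ω, ‖G x‖ₑ ^ (2 : ℝ) :=
    lintegral_lintegral_enorm_sub_le_of_tendsto (fun k ↦ (hfc k).continuous.measurable) hlim hsm
  have hum : AEStronglyMeasurable u (volume.restrict B) :=
    hw.integrable.aestronglyMeasurable.restrict
  have : IsFiniteMeasure (volume.restrict B) :=
    isFiniteMeasure_restrict.2 measure_ball_lt_top.ne
  -- The constant is a value of `u` at a point where the inner integral does not exceed its average
  -- over the ball.
  obtain ⟨x, hx⟩ := exists_le_laverage (μ := volume.restrict B)
    (f := fun x ↦ ∫⁻ y in B, ‖u y - u x‖ₑ ^ (2 : ℝ))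
    (by rwa [Ne, Measure.restrict_eq_zero])
    (((hum.comp_snd.sub hum.comp_fst).enorm.pow_const _).lintegral_prod_right')
  refine ⟨u x, ?_⟩
  rw [setLAverage_eq, ENNReal.div_eq_inv_mul] at hx
  calc ∫⁻ y in B, ‖R y - u x‖ₑ ^ (2 : ℝ) = ∫⁻ y in B, ‖u y - u x‖ₑ ^ (2 : ℝ) := by
        refine setLIntegral_congr_fun measurableSet_ball fun y hy ↦ ?_
        simp [u, hBΩ hy]
    _ ≤ _ := hx
    _ ≤ _ := by
        rw [mul_assoc]
        exact mul_le_mul_right hdouble _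

theorem PoincareOn.union (hS : PoincareOn Ω S) (hT : PoincareOn Ω T) (hSΩ : S ⊆ Ω) (hTΩ : T ⊆ Ω)
    (hTb : volume T ≠ ⊤) (hST : volume (S ∩ T) ≠ 0) : PoincareOn Ω (S ∪ T) := by
  obtain ⟨C, hC, hS⟩ := hS
  obtain ⟨C', hC', hT⟩ := hT
  set v := volume (S ∩ T)
  have hv : v ≠ ⊤ := measure_ne_top_of_subset Set.inter_subset_right hTb
  set K : ℝ≥0∞ := 2 * (C + C') * v⁻¹ with hK
  refine ⟨C + 2 * (C' + K * volume T), ?_, fun R G h ↦ ?_⟩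
  · have hKt : K ≠ ⊤ := ENNReal.mul_ne_top (ENNReal.mul_ne_top (by simp) (by simp [hC, hC']))
      (by simpa using hST)
    exact ENNReal.add_ne_top.2 ⟨hC, ENNReal.mul_ne_top (by simp)
      (ENNReal.add_ne_top.2 ⟨hC', ENNReal.mul_ne_top hKt hTb⟩)⟩
  obtain ⟨c, hc⟩ := hS R G h
  obtain ⟨c', hc'⟩ := hT R G h
  set N := ∫⁻ x in Ω, ‖G x‖ₑ ^ (2 : ℝ)
  have hm : ∀ (d : ℝ) (A : Set (EuclideanSpace ℝ (Fin n))), A ⊆ Ω →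
      AEMeasurable (fun x ↦ ‖R x - d‖ₑ ^ (2 : ℝ)) (volume.restrict A) := fun d A hA ↦
    ((h.memLp.aestronglyMeasurable.mono_measure (Measure.restrict_mono_set _ hA)).sub
      aestronglyMeasurable_const).enorm.pow_const _
  -- `R` is close to both constants on the overlap, whose measure is positive, so the constants are
  -- close to each other.
  have hcc : ‖c' - c‖ₑ ^ (2 : ℝ) ≤ K * N := by
    have h1 : ‖c' - c‖ₑ ^ (2 : ℝ) * v ≤ 2 * (C + C') * N := by
      rw [← setLIntegral_const]
      calc ∫⁻ _ in S ∩ T, ‖c' - c‖ₑ ^ (2 : ℝ)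
          ≤ ∫⁻ x in S ∩ T, 2 * (‖R x - c‖ₑ ^ (2 : ℝ) + ‖R x - c'‖ₑ ^ (2 : ℝ)) := by
            refine lintegral_mono fun x ↦ le_trans (ENNReal.rpow_le_rpow ?_ (by norm_num))
              (ENNReal.add_sq_le _ _)
            rw [show c' - c = (R x - c) - (R x - c') by ring]
            exact enorm_sub_le
        _ = 2 * ((∫⁻ x in S ∩ T, ‖R x - c‖ₑ ^ (2 : ℝ)) +
              ∫⁻ x in S ∩ T, ‖R x - c'‖ₑ ^ (2 : ℝ)) := by
            rw [lintegral_const_mul' _ _ (by simp),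
              lintegral_add_left' (hm c _ (Set.inter_subset_left.trans hSΩ))]
        _ ≤ 2 * (C * N + C' * N) := by
            gcongr
            · exact (lintegral_mono_set Set.inter_subset_left).trans hc
            · exact (lintegral_mono_set Set.inter_subset_right).trans hc'
        _ = _ := by ring
    calc ‖c' - c‖ₑ ^ (2 : ℝ) = ‖c' - c‖ₑ ^ (2 : ℝ) * v * v⁻¹ := by
          rw [mul_assoc, ENNReal.mul_inv_cancel hST hv, mul_one]
      _ ≤ 2 * (C + C') * N * v⁻¹ := by gcongr
      _ = _ := by rw [hK]; ring
  refine ⟨c, (lintegral_union_le _ _ _).trans ?_⟩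
  rw [add_mul]
  refine add_le_add hc ?_
  calc ∫⁻ x in T, ‖R x - c‖ₑ ^ (2 : ℝ)
      ≤ ∫⁻ x in T, 2 * (‖R x - c'‖ₑ ^ (2 : ℝ) + ‖c' - c‖ₑ ^ (2 : ℝ)) := by
        refine lintegral_mono fun x ↦ le_trans (ENNReal.rpow_le_rpow ?_ (by norm_num))
          (ENNReal.add_sq_le _ _)
        rw [show R x - c = (R x - c') + (c' - c) by ring]
        exact enorm_add_le _ _
    _ = 2 * ((∫⁻ x in T, ‖R x - c'‖ₑ ^ (2 : ℝ)) + ‖c' - c‖ₑ ^ (2 : ℝ) * volume T) := by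
        rw [lintegral_const_mul' _ _ (by simp), lintegral_add_left' (hm c' _ hTΩ),
          setLIntegral_const]
    _ ≤ 2 * (C' * N + K * N * volume T) := by gcongr
    _ = _ := by ring

theorem PoincareOn.union_of_isOpen (hb : Bornology.IsBounded Ω) (hS : PoincareOn Ω S)
    (hT : PoincareOn Ω T) (hSΩ : S ⊆ Ω) (hTΩ : T ⊆ Ω) (hSo : IsOpen S) (hTo : IsOpen T)
    (hne : (S ∩ T).Nonempty) : PoincareOn Ω (S ∪ T) :=
  hS.union hT hSΩ hTΩ (measure_ne_top_of_subset hTΩ hb.measure_lt_top.ne)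
    ((hSo.inter hTo).measure_pos _ hne).ne'

theorem exists_poincareOn_of_mem (hΩ : IsOpen Ω) (hb : Bornology.IsBounded Ω)
    {x : EuclideanSpace ℝ (Fin n)} (hx : x ∈ Ω) :
    ∃ S ⊆ Ω, IsOpen S ∧ x ∈ S ∧ PoincareOn Ω S := by
  obtain ⟨r, hr, hball⟩ := Metric.isOpen_iff.1 hΩ x hx
  refine ⟨Metric.ball x (r / 2), (Metric.ball_subset_ball (by linarith)).trans hball,
    Metric.isOpen_ball, Metric.mem_ball_self (by positivity),
    poincareOn_ball hΩ hb (by positivity) ?_⟩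
  rwa [mul_div_cancel₀ _ two_ne_zero]

theorem exists_poincareOn_superset (hΩ : IsOpen Ω) (hb : Bornology.IsBounded Ω)
    (hc : IsConnected Ω) {K : Set (EuclideanSpace ℝ (Fin n))} (hK : IsCompact K) (hKΩ : K ⊆ Ω) :
    ∃ S, K ⊆ S ∧ PoincareOn Ω S := by
  obtain ⟨x₀, hx₀⟩ := hc.nonempty
  have hpair : ∀ y ∈ Ω, ∃ S ⊆ Ω, IsOpen S ∧ x₀ ∈ S ∧ y ∈ S ∧ PoincareOn Ω S := by
    intro y hy
    -- Lying in a common open Poincaré set is symmetric, transitive by gluing along the shared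
    -- point, and holds locally, so it relates all pairs in a connected set.
    refine hc.isPreconnected.induction₂
      (fun x y ↦ ∃ S ⊆ Ω, IsOpen S ∧ x ∈ S ∧ y ∈ S ∧ PoincareOn Ω S) ?_ ?_ ?_ hx₀ hy
    · intro x hx
      obtain ⟨S, hSΩ, hSo, hxS, hS⟩ := exists_poincareOn_of_mem hΩ hb hx
      filter_upwards [mem_nhdsWithin_of_mem_nhds (hSo.mem_nhds hxS)] with z hz
      exact ⟨S, hSΩ, hSo, hxS, hz, hS⟩
    · rintro x y z - - - ⟨S, hSΩ, hSo, hxS, hyS, hS⟩ ⟨T, hTΩ, hTo, hyT, hzT, hT⟩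
      exact ⟨S ∪ T, Set.union_subset hSΩ hTΩ, hSo.union hTo, .inl hxS, .inr hzT,
        hS.union_of_isOpen hb hT hSΩ hTΩ hSo hTo ⟨y, hyS, hyT⟩⟩
    · rintro x y - - ⟨S, hSΩ, hSo, hxS, hyS, hS⟩
      exact ⟨S, hSΩ, hSo, hyS, hxS, hS⟩
  have : ∃ S ⊆ Ω, IsOpen S ∧ x₀ ∈ S ∧ PoincareOn Ω S ∧ K ⊆ S := by
    refine hK.induction_on (p := fun K ↦ ∃ S ⊆ Ω, IsOpen S ∧ x₀ ∈ S ∧ PoincareOn Ω S ∧ K ⊆ S)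
      ?_ ?_ ?_ ?_
    · obtain ⟨S, hSΩ, hSo, hxS, hS⟩ := exists_poincareOn_of_mem hΩ hb hx₀
      exact ⟨S, hSΩ, hSo, hxS, hS, Set.empty_subset _⟩
    · rintro s t hst ⟨S, h1, h2, h3, h4, h5⟩
      exact ⟨S, h1, h2, h3, h4, hst.trans h5⟩
    · rintro s t ⟨S, hSΩ, hSo, hxS, hS, hs⟩ ⟨T, hTΩ, hTo, hxT, hT, ht⟩
      exact ⟨S ∪ T, Set.union_subset hSΩ hTΩ, hSo.union hTo, .inl hxS,
        hS.union_of_isOpen hb hT hSΩ hTΩ hSo hTo ⟨x₀, hxS, hxT⟩, Set.union_subset_union hs ht⟩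
    · intro y hy
      obtain ⟨S, hSΩ, hSo, hxS, hyS, hS⟩ := hpair y (hKΩ hy)
      exact ⟨S, mem_nhdsWithin_of_mem_nhds (hSo.mem_nhds hyS), S, hSΩ, hSo, hxS, hS, subset_rfl⟩
  obtain ⟨S, -, -, -, hS, hKS⟩ := this
  exact ⟨S, hKS, hS⟩

end

/-! ### Poincaré and Sobolev–Poincaré inequalities on `Ω` -/

section

variable {n : ℕ} {Ω : Set (EuclideanSpace ℝ (Fin n))} {R : EuclideanSpace ℝ (Fin n) → ℝ}
  {G : EuclideanSpace ℝ (Fin n) → EuclideanSpace ℝ (Fin n)}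

theorem integral_fderiv_eq_zero {E : Type*} [NormedAddCommGroup E] [NormedSpace ℝ E]
    [FiniteDimensional ℝ E] [MeasurableSpace E] [BorelSpace E] {μ : Measure E}
    [μ.IsAddHaarMeasure] {φ : E → ℝ} (hφ : ContDiff ℝ 1 φ) (hφc : HasCompactSupport φ) (w : E) :
    ∫ x, fderiv ℝ φ x w ∂μ = 0 := by
  have hi : Integrable (fun x ↦ fderiv ℝ φ x w) μ :=
    ((hφ.continuous_fderiv one_ne_zero).clm_apply continuous_const).integrable_of_hasCompactSupport
      (hφc.fderiv_apply ℝ w)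
  have := integral_mul_fderiv_eq_neg_fderiv_mul_of_integrable (μ := μ) (f := fun _ : E ↦ (1 : ℝ))
    (g := φ) (v := w) (by simp) (by simpa using hi)
    (by simpa using hφ.continuous.integrable_of_hasCompactSupport hφc)
    (fun x _ ↦ differentiableAt_const _) (fun x _ ↦ hφ.differentiable one_ne_zero x)
  simpa using this

theorem IsH1Pair.sub_const (h : IsH1Pair Ω R G) (hb : Bornology.IsBounded Ω) (c : ℝ) :
    IsH1Pair Ω (fun x ↦ R x - c) G := by
  have : IsFiniteMeasure (volume.restrict Ω) := isFiniteMeasure_restrict.2 hb.measure_lt_top.ne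
  refine ⟨⟨h.weak.locallyIntegrable.sub ((locallyIntegrable_const c).locallyIntegrableOn Ω),
    h.weak.locallyIntegrable_grad, fun φ hφ hφc hφΩ i ↦ ?_⟩, h.memLp.sub (memLp_const c),
    h.memLp_grad⟩
  have hR : Integrable R (volume.restrict Ω) := h.memLp.integrable (by norm_num)
  have h0 : ∫ x in Ω, fderiv ℝ φ x (EuclideanSpace.single i 1) = 0 := by
    rw [setIntegral_eq_integral_of_forall_compl_eq_zero, integral_fderiv_eq_zero
      (hφ.of_le (by simp)) hφc]
    intro x hx
    have : x ∉ tsupport φ := fun hx' ↦ hx (hφΩ hx')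
    rw [fderiv_of_notMem_tsupport ℝ this]
    rfl
  simp_rw [sub_mul]
  rw [integral_sub (integrable_mul_fderiv hR hφ hφc _)
    (integrable_mul_fderiv (integrable_const c) hφ hφc _), integral_const_mul, h0, mul_zero,
    sub_zero, h.weak.integral_eq φ hφ hφc hφΩ i]

theorem exists_pos_mul_rpow_le {C : ℝ≥0∞} (hC : C ≠ ⊤) {a : ℝ} (ha : 0 < a) :
    ∃ ε : ℝ≥0∞, ε ≠ 0 ∧ ε ^ a * C ≤ 1 / 2 := by
  refine ⟨((2 * (C + 1))⁻¹) ^ (1 / a), ?_, ?_⟩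
  · have : 2 * (C + 1) ≠ ⊤ := ENNReal.mul_ne_top (by simp) (by simp [hC])
    simp [ENNReal.rpow_eq_zero_iff, this]
  · rw [← ENNReal.rpow_mul, one_div_mul_cancel ha.ne', ENNReal.rpow_one,
      ENNReal.mul_inv (by simp) (by simp), mul_assoc, one_div]
    refine mul_le_of_le_one_right' ?_
    calc (C + 1)⁻¹ * C ≤ (C + 1)⁻¹ * (C + 1) := by gcongr; exact le_self_add
      _ ≤ 1 := ENNReal.inv_mul_le_one _

theorem IsH1Pair.lintegral_ne_top (h : IsH1Pair Ω R G) :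
    ∫⁻ x in Ω, ‖R x‖ₑ ^ (2 : ℝ) ≠ ⊤ := by
  have := lintegral_rpow_enorm_lt_top_of_eLpNorm_lt_top (by norm_num) (by norm_num)
    h.memLp.eLpNorm_lt_top
  simpa using this.ne

theorem poincareOn_self (hn : 1 ≤ n) (hΩ : IsOpen Ω) (hc : IsConnected Ω)
    (hb : Bornology.IsBounded Ω) (hbd : HasC1Boundary Ω) : PoincareOn Ω Ω := by
  obtain ⟨q, hq, hqn⟩ : ∃ q : ℝ, 2 < q ∧ ((n : ℝ) - 2) * q ≤ 2 * n := by
    have hn' : (0 : ℝ) < n := by exact_mod_cast hn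
    refine ⟨2 + 4 / n, by have : 0 < 4 / (n : ℝ) := by positivity
                          linarith, ?_⟩
    field_simp
    nlinarith
  obtain ⟨C, hC, hsob⟩ := exists_sobolev hn hΩ hb hbd hq hqn
  have ha : 0 < 1 - 2 / q := by rw [sub_pos, div_lt_one (by linarith)]; exact hq
  have hq0 : 0 ≤ 2 / q := by positivity
  -- `ε` will bound the measure of the layer `Ω \ K`; it is small enough for Hölder and Sobolev to
  -- leave a factor `1 / 2` there.
  obtain ⟨ε, hε, hεC⟩ := exists_pos_mul_rpow_le (ENNReal.rpow_ne_top_of_nonneg hq0 hC) ha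
  obtain ⟨K, hKΩ, hK, hKε⟩ :=
    hΩ.measurableSet.exists_isCompact_sdiff_lt (μ := volume) hb.measure_lt_top.ne hε
  obtain ⟨S, hKS, C', hC', hS⟩ := exists_poincareOn_superset hΩ hb hc hK hKΩ
  refine ⟨2 * C' + 1, by simp [ENNReal.mul_ne_top, hC'], fun R G h ↦ ?_⟩
  obtain ⟨c, hcS⟩ := hS R G h
  refine ⟨c, ?_⟩
  have h' := h.sub_const hb c
  have hfin := h'.lintegral_ne_top
  have hsob' := hsob _ _ h'
  set N := ∫⁻ x in Ω, ‖G x‖ₑ ^ (2 : ℝ)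
  set A := ∫⁻ x in Ω, ‖R x - c‖ₑ ^ (2 : ℝ)
  have hcompl : ∫⁻ x in Ω \ K, ‖R x - c‖ₑ ^ (2 : ℝ) ≤ 1 / 2 * (A + N) := by
    have hm : AEMeasurable (fun x ↦ ‖R x - c‖ₑ) (volume.restrict (Ω \ K)) :=
      (h'.memLp.aestronglyMeasurable.mono_measure
        (Measure.restrict_mono_set _ Set.sdiff_subset)).enorm
    calc ∫⁻ x in Ω \ K, ‖R x - c‖ₑ ^ (2 : ℝ)
        ≤ volume (Ω \ K) ^ (1 - 2 / q) *
            (∫⁻ x in Ω \ K, ‖R x - c‖ₑ ^ q) ^ (2 / q) := by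
          simpa using lintegral_rpow_le_of_support (K := Set.univ) two_pos hq.le hm (by simp)
      _ ≤ ε ^ (1 - 2 / q) * (C * (A + N) ^ (q / 2)) ^ (2 / q) := by
          gcongr
          exact (lintegral_mono_set Set.sdiff_subset).trans hsob'
      _ = ε ^ (1 - 2 / q) * C ^ (2 / q) * (A + N) := by
          rw [ENNReal.mul_rpow_of_nonneg _ _ hq0, ← ENNReal.rpow_mul,
            div_mul_div_cancel₀ two_ne_zero, div_self (by linarith), ENNReal.rpow_one, mul_assoc]
      _ ≤ _ := by gcongr
  have hA : A ≤ C' * N + 1 / 2 * (A + N) := by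
    calc A ≤ ∫⁻ x in S ∪ Ω \ K, ‖R x - c‖ₑ ^ (2 : ℝ) :=
          lintegral_mono_set fun x hx ↦ (em (x ∈ K)).imp (fun h ↦ hKS h) fun h ↦ ⟨hx, h⟩
      _ ≤ _ := (lintegral_union_le _ _ _).trans (add_le_add hcS hcompl)
  have hhalf : A / 2 ≤ C' * N + N / 2 := by
    have hA2 : A / 2 ≠ ⊤ := ENNReal.div_ne_top hfin (by simp)
    -- Absorbing `A / 2` is legitimate because `A` is finite, `R - c` being square integrable.
    rw [← ENNReal.add_le_add_iff_left hA2, ENNReal.add_halves]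
    refine hA.trans_eq ?_
    simp only [div_eq_mul_inv]
    ring
  calc A = 2 * (A / 2) := (ENNReal.mul_div_cancel (by simp) (by simp)).symm
    _ ≤ 2 * (C' * N + N / 2) := by gcongr
    _ = (2 * C' + 1) * N := by
        rw [mul_add, ENNReal.mul_div_cancel (by simp) (by simp)]; ring

/-- On expanding the square the cross term vanishes. This replaces the unspecified constant in
`PoincareOn` by the mean, zero. -/
theorem lintegral_enorm_sq_le_of_integral_eq_zero {α : Type*} [MeasurableSpace α] {μ : Measure α}
    [IsFiniteMeasure μ] {f : α → ℝ} (hf : MemLp f 2 μ) (h0 : ∫ x, f x ∂μ = 0) (c : ℝ) :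
    ∫⁻ x, ‖f x‖ₑ ^ (2 : ℝ) ∂μ ≤ ∫⁻ x, ‖f x - c‖ₑ ^ (2 : ℝ) ∂μ := by
  have key : ∀ g : α → ℝ, MemLp g 2 μ →
      ∫⁻ x, ‖g x‖ₑ ^ (2 : ℝ) ∂μ = ENNReal.ofReal (∫ x, g x ^ 2 ∂μ) := fun g hg ↦ by
    rw [ofReal_integral_eq_lintegral_ofReal hg.integrable_sq (.of_forall fun x ↦ sq_nonneg _)]
    refine lintegral_congr fun x ↦ ?_
    rw [← sq_abs, ENNReal.ofReal_pow (abs_nonneg _), ← Real.enorm_eq_ofReal_abs]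
    norm_cast
  have hi : Integrable f μ := hf.integrable (by norm_num)
  have hg : MemLp (fun x ↦ f x - c) 2 μ := hf.sub (memLp_const c)
  rw [key f hf, key _ hg]
  refine ENNReal.ofReal_le_ofReal ?_
  have e : ∀ x, (f x - c) ^ 2 = f x ^ 2 - 2 * c * f x + c ^ 2 := fun x ↦ by ring
  simp_rw [e]
  have hs : Integrable (fun x ↦ f x ^ 2 - 2 * c * f x) μ := hf.integrable_sq.sub (hi.const_mul _)
  rw [integral_add hs (integrable_const _),
    integral_sub hf.integrable_sq (hi.const_mul _), integral_const_mul, h0]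
  have : 0 ≤ ∫ _ : α, c ^ 2 ∂μ := integral_nonneg fun _ ↦ sq_nonneg c
  linarith

/-- The Sobolev–Poincaré inequality. -/
theorem exists_sobolev_poincare (hn : 1 ≤ n) (hΩ : IsOpen Ω) (hc : IsConnected Ω)
    (hb : Bornology.IsBounded Ω) (hbd : HasC1Boundary Ω) {q : ℝ} (hq : 2 < q)
    (hqn : ((n : ℝ) - 2) * q ≤ 2 * n) :
    ∃ C : ℝ≥0∞, C ≠ ⊤ ∧ ∀ R G, IsH1Pair Ω R G → ∫ x in Ω, R x = 0 →
      ∫⁻ x in Ω, ‖R x‖ₑ ^ q ≤ C * (∫⁻ x in Ω, ‖G x‖ₑ ^ (2 : ℝ)) ^ (q / 2) := by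
  have : IsFiniteMeasure (volume.restrict Ω) := isFiniteMeasure_restrict.2 hb.measure_lt_top.ne
  obtain ⟨C, hC, hsob⟩ := exists_sobolev hn hΩ hb hbd hq hqn
  obtain ⟨D, hD, hpoin⟩ := poincareOn_self hn hΩ hc hb hbd
  have hq0 : 0 ≤ q / 2 := by linarith
  refine ⟨C * (D + 1) ^ (q / 2), ENNReal.mul_ne_top hC
    (ENNReal.rpow_ne_top_of_nonneg hq0 (by simp [hD])), fun R G h h0 ↦ ?_⟩
  obtain ⟨c, hRc⟩ := hpoin R G h
  have h2 := (lintegral_enorm_sq_le_of_integral_eq_zero h.memLp h0 c).trans hRc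
  refine (hsob R G h).trans ?_
  rw [mul_assoc, ← ENNReal.mul_rpow_of_nonneg _ _ hq0, add_mul, one_mul]
  gcongr

end

/-! ### Interpolation and conclusion -/

theorem lintegral_rpow_two_add_le {α : Type*} [MeasurableSpace α] {μ : Measure α}
    {f : α → ℝ≥0∞} (hf : AEMeasurable f μ) {p : ℝ} (hp : 0 < p) (hp2 : p < 2) :
    ∫⁻ x, f x ^ (2 + p) ∂μ ≤ (∫⁻ x, f x ^ (2 : ℝ) ∂μ) ^ (p / 2) *
      (∫⁻ x, f x ^ (4 / (2 - p)) ∂μ) ^ ((2 - p) / 2) := by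
  have hp' : 0 < 2 - p := by linarith
  refine le_trans (le_of_eq ?_) (ENNReal.lintegral_mul_norm_pow_le (hf.pow_const _)
    (hf.pow_const _) (by positivity) (by positivity) (by ring))
  refine lintegral_congr fun x ↦ ?_
  rw [← ENNReal.rpow_mul, ← ENNReal.rpow_mul, ← ENNReal.rpow_add_of_nonneg _ _ (by positivity)
    (by positivity)]
  congr 1
  field_simp
  ring

theorem lemma1 (n : ℕ) (hn : 1 ≤ n) (Ω : Set (EuclideanSpace ℝ (Fin n)))
    (hΩ_open : IsOpen Ω) (hΩ_conn : IsConnected Ω) (hΩ_bdd : Bornology.IsBounded Ω)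
    (hΩ_bdry : HasC1Boundary Ω) (p : ℝ) (hp : p = min (4 / (n : ℝ)) 1) :
    ∃ C : ℝ, 0 < C ∧
      ∀ R : EuclideanSpace ℝ (Fin n) → ℝ, MemH1 Ω R → ∫ x in Ω, R x = 0 →
        ∀ G : EuclideanSpace ℝ (Fin n) → EuclideanSpace ℝ (Fin n), IsWeakGradient Ω R G →
          eLpNorm R (ENNReal.ofReal (2 + p)) (volume.restrict Ω) ^ (2 + p) ≤
            ENNReal.ofReal C * eLpNorm R 2 (volume.restrict Ω) ^ p *
              eLpNorm G 2 (volume.restrict Ω) ^ (2 : ℝ) := by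
  have hn' : (0 : ℝ) < n := by exact_mod_cast hn
  have hp0 : 0 < p := hp ▸ lt_min (by positivity) one_pos
  have hp1 : p ≤ 1 := hp ▸ min_le_right _ _
  have hpn : n * p ≤ 4 := by
    have : p ≤ 4 / n := hp ▸ min_le_left _ _
    rw [le_div_iff₀ hn'] at this
    linarith
  have hp2 : 0 < 2 - p := by linarith
  obtain ⟨C, hC, key⟩ := exists_sobolev_poincare hn hΩ_open hΩ_conn hΩ_bdd hΩ_bdry
    (q := 4 / (2 - p)) (by rw [lt_div_iff₀ hp2]; linarith)
    (by rw [mul_div_assoc', div_le_iff₀ hp2]; linarith)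
  set D := C ^ ((2 - p) / 2) with hD
  have hDt : D ≠ ⊤ := ENNReal.rpow_ne_top_of_nonneg (by positivity) hC
  -- Adding `1` keeps the constant positive even if `D = 0`.
  refine ⟨D.toReal + 1, by positivity, fun R hR h0 G hG ↦ ?_⟩
  have hDC : D ≤ ENNReal.ofReal (D.toReal + 1) := by
    rw [← ENNReal.ofReal_toReal hDt]
    exact ENNReal.ofReal_le_ofReal (by simp)
  have hRm := hR.1.aestronglyMeasurable
  rcases eq_or_ne (eLpNorm R 2 (volume.restrict Ω)) 0 with hR0 | hR0
  · have hae := (eLpNorm_eq_zero_iff hRm (by norm_num)).1 hR0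
    rw [eLpNorm_congr_ae hae, eLpNorm_zero, ENNReal.zero_rpow_of_pos (by linarith)]
    exact zero_le
  -- `G` need not be the square integrable gradient supplied by `hR`. If its norm is infinite the
  -- right side is `⊤`, since `R` has nonzero norm; uniqueness of weak gradients is not needed.
  rcases eq_or_ne (eLpNorm G 2 (volume.restrict Ω)) ⊤ with hGt | hGt
  · rw [hGt, ENNReal.top_rpow_of_pos two_pos, ENNReal.mul_top]
    · exact le_top
    · refine mul_ne_zero (ENNReal.ofReal_pos.2 (by positivity)).ne' ?_
      simp [ENNReal.rpow_eq_zero_iff, hR0, hp0.le]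
  have hpair : IsH1Pair Ω R G := ⟨hG, hR.1,
    hG.locallyIntegrable_grad.aestronglyMeasurable, lt_top_iff_ne_top.2 hGt⟩
  have hnorm : ∀ {F : Type} [NormedAddCommGroup F] (f : EuclideanSpace ℝ (Fin n) → F),
      eLpNorm f 2 (volume.restrict Ω) = (∫⁻ x in Ω, ‖f x‖ₑ ^ (2 : ℝ)) ^ (1 / 2 : ℝ) := by
    intro F _ f
    rw [eLpNorm_eq_lintegral_rpow_enorm_toReal (by norm_num) (by norm_num)]
    simp
  have hnorm' : eLpNorm R (ENNReal.ofReal (2 + p)) (volume.restrict Ω) ^ (2 + p) =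
      ∫⁻ x in Ω, ‖R x‖ₑ ^ (2 + p) := by
    rw [eLpNorm_eq_lintegral_rpow_enorm_toReal (by simpa using by linarith) (by simp),
      ENNReal.toReal_ofReal (by linarith), ← ENNReal.rpow_mul,
      one_div_mul_cancel (by linarith), ENNReal.rpow_one]
  rw [hnorm', hnorm, hnorm, ← ENNReal.rpow_mul, ← ENNReal.rpow_mul]
  calc ∫⁻ x in Ω, ‖R x‖ₑ ^ (2 + p)
      ≤ (∫⁻ x in Ω, ‖R x‖ₑ ^ (2 : ℝ)) ^ (p / 2) *
          (∫⁻ x in Ω, ‖R x‖ₑ ^ (4 / (2 - p))) ^ ((2 - p) / 2) :=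
        lintegral_rpow_two_add_le hRm.enorm hp0 (by linarith)
    _ ≤ (∫⁻ x in Ω, ‖R x‖ₑ ^ (2 : ℝ)) ^ (p / 2) *
          (C * (∫⁻ x in Ω, ‖G x‖ₑ ^ (2 : ℝ)) ^ (4 / (2 - p) / 2)) ^ ((2 - p) / 2) := by
        gcongr
        exact key R G hpair h0
    _ = D * (∫⁻ x in Ω, ‖R x‖ₑ ^ (2 : ℝ)) ^ (p / 2) * ∫⁻ x in Ω, ‖G x‖ₑ ^ (2 : ℝ) := by
        have e : 4 / (2 - p) / 2 * ((2 - p) / 2) = 1 := by field_simp; norm_num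
        rw [ENNReal.mul_rpow_of_nonneg _ _ (by positivity), ← ENNReal.rpow_mul, e,
          ENNReal.rpow_one, hD]
        ring
    _ ≤ _ := by
        rw [one_div_mul_cancel two_ne_zero, ENNReal.rpow_one, one_div_mul_eq_div]
        gcongr
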